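/- Let $K$ be a field. A graded filtered Floer–Novikov complex over $K$ consists of the following data. 1. A principal $\Gamma$-bundle $\pi\colon P\to S$, where $\Gamma$ is a finitely generated abelian group (written multiplicatively) and $S$ is a finite set; that is, $\Gamma$ acts freely on the set $P$, and $\pi$ is a surjection whose fibres are the $\Gamma$-orbits. 2. A function $\mathcal A\colon P\to\mathbb R$ and a homomorphism $\omega\colon\Gamma\to\mathbb R$ with $\mathcal A(g\cdot p)=\mathcal A(p)-\omega(g)$, and a function $\mathrm{gr}\colon P\to\mathbb Z$ and a homomorphism $\deg\colon\Gamma\to\mathbb Z$ with $\mathrm{gr}(g\cdot p)=\mathrm{gr}(p)-\deg(g)$. Let $$C_k=\Big\{\sum_{\mathrm{gr}(p)=k}a_pp \;\Big|\; a_p\in K,\ \#\{p: a_p\ne0,\ \mathcal A(p)>C\}<\infty\ \text{for all } C\in\mathbb R\Big\},\qquad C_*=\bigoplus_{k\in\mathbb Z}C_k,$$ and $\ell\big(\sum a_pp\big)=\max\{\mathcal A(p): a_p\neq0\}$, with $\ell(0)=-\infty$. Let $\bar\Lambda$ be the Novikov ring of formal sums $\sum_{g\in\Gamma}b_gg$ with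 $b_g\in K$, such that $\deg$ takes only finitely many values on $\{g : b_g\ne0\}$ and $\#\{g: b_g\neq0,\ \omega(g)<C\}<\infty$ for all $C\in\mathbb R$. It acts on $C_*$ by extension of the $\Gamma$-action on $P$. 3. A $\bar\Lambda$-module endomorphism $\partial\colon C_*\to C_*$ with $\partial^2=0$, $\partial(C_k)\subset C_{k-1}$ for all $k$, and $\ell(\partial c)<\ell(c)$ for all $c\neq0$. Write $\partial p=\sum_q n(p,q)q$ for $p\in P$. The opposite complex is the graded filtered Floer–Novikov complex with the same $\pi\colon P\to S$, the inverse action $g\cdot^{op}p=g^{-1}\cdot p$, the functions $-\mathcal A$ and $-\mathrm{gr}$, the same $\omega$ and $\deg$, and the boundary operator $\delta$ given by $\delta p=\sum_q n(q,p)q$, that is, $\delta\big(\sum_p d_pp\big)=\sum_q\big(\sum_p d_p\,n(q,p)\big)q$. Let $D_*$ be its chain complex and $\ell^{op}$ the corresponding function on $D_*$. The pairing $$\Delta\colon D_*\times C_*\to K,\qquad \Delta\Big(\sum_p d_pp,\sum_q c_qq\Big)=\sum_{p\in P}d_pc_p$$ satisfies $\Delta(\delta d,c)=\Delta(d,\partial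 c)$. For $\alpha\in\mathbb R$ it vanishes on $D_*^{(-\infty,-\alpha)}\times C_*^{(-\infty,\alpha]}$, where $D_*^{(-\infty,-\alpha)}=\{d\in D_* : \ell^{op}(d)<-\alpha\}$ and $C_*^{(-\infty,\alpha]}=\{c\in C_* : \ell(c)\le\alpha\}$ are subcomplexes. Hence, with $C_*^{(\alpha,\infty)}=C_*/C_*^{(-\infty,\alpha]}$, it induces for every $k\in\mathbb Z$ a $K$-bilinear pairing $$\underline\Delta_\alpha\colon H_{-k}\big(D_*^{(-\infty,-\alpha)}\big)\times H_k\big(C_*^{(\alpha,\infty)}\big)\to K.$$ **Theorem.** Suppose that $\omega$ is injective on $\Gamma_0=\ker(\deg)$. Then for all $\alpha\in\mathbb R$ and $k\in\mathbb Z$ the pairing $\underline\Delta_\alpha$ is nondegenerate: for every nonzero $b\in H_{-k}(D_*^{(-\infty,-\alpha)})$ there is $a\in H_k(C_*^{(\alpha,\infty)})$ with $\underline\Delta_\alpha(b,a)\ne0$, and for every nonzero $a\in H_k(C_*^{(\alpha,\infty)})$ there is $b\in H_{-k}(D_*^{(-\infty,-\alpha)})$ with $\underline\Delta_\alpha(b,a)\neq0$.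 -/

import Mathlib

/-- The combinatorial part of a graded filtered Floer--Novikov complex: a principal `Γ`-bundle
`proj : P → S` (with `Γ` a finitely generated abelian group, written multiplicatively, and `S` a
finite set), the action functional, the period homomorphism `ω : Γ → ℝ`, the grading and the degree
homomorphism `deg : Γ → ℤ`.  The `Γ`-action is a field because the opposite complex carries another
action of `Γ` on the same set `P`. -/
structure FloerNovikovData (Γ P S : Type*) [CommGroup Γ] where
  fg : Group.FG Γ
  finite_base : Finite S
  act : Γ → P → P
  one_act : ∀ p, act 1 p = p
  mul_act : ∀ g h p, act (g * h) p = act g (act h p)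
  free : ∀ g p, act g p = p → g = 1
  proj : P → S
  proj_surjective : Function.Surjective proj
  proj_eq_iff : ∀ p q, proj p = proj q ↔ ∃ g, act g p = q
  action : P → ℝ
  period : Γ → ℝ
  period_mul : ∀ g h, period (g * h) = period g + period h
  action_act : ∀ g p, action (act g p) = action p - period g
  gr : P → ℤ
  deg : Γ → ℤ
  deg_mul : ∀ g h, deg (g * h) = deg g + deg h
  gr_act : ∀ g p, gr (act g p) = gr p - deg g

namespace FloerNovikovData

variable {Γ P S : Type*} [CommGroup Γ] (X : FloerNovikovData Γ P S)

theorem exists_of_finsum {ι K : Type*} [Field K] {f : ι → K} (h : ∑ᶠ i, f i ≠ 0) :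
    ∃ i, f i ≠ 0 := by
  by_contra! h'
  exact h ((finsum_congr h').trans finsum_zero)

theorem period_one : X.period 1 = 0 := by
  have := X.period_mul 1 1
  simp only [mul_one] at this
  linarith

theorem period_inv (g : Γ) : X.period g⁻¹ = - X.period g := by
  have := X.period_mul g g⁻¹
  rw [mul_inv_cancel, X.period_one] at this
  linarith

theorem deg_one : X.deg 1 = 0 := by
  have := X.deg_mul 1 1
  simp only [mul_one] at this
  linarith

theorem deg_inv (g : Γ) : X.deg g⁻¹ = - X.deg g := by
  have := X.deg_mul g g⁻¹
  rw [mul_inv_cancel, X.deg_one] at this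
  linarith

theorem act_inv_act (g : Γ) (p : P) : X.act g⁻¹ (X.act g p) = p := by
  rw [← X.mul_act, inv_mul_cancel, X.one_act]

theorem act_act_inv (g : Γ) (p : P) : X.act g (X.act g⁻¹ p) = p := by
  rw [← X.mul_act, mul_inv_cancel, X.one_act]

theorem act_left_injective (p : P) : Function.Injective (fun g => X.act g p) := by
  intro g h hgh
  have hgh' : X.act g p = X.act h p := hgh
  have : X.act (h⁻¹ * g) p = p := by rw [X.mul_act, hgh', X.act_inv_act]
  have h1 := X.free _ _ this
  exact (inv_mul_eq_one.mp h1).symm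

section Chains

variable (K : Type*) [Field K]

/-- The full Floer chain complex `C_* = ⨁ₖ Cₖ`, as a `K`-vector space.  An element is a formal sum
`∑ c_p p`, i.e. a function `c : P → K`, involving finitely many gradings and such that for each
real `C` only finitely many `p` with `c_p ≠ 0` have action `> C`. -/
def chains : Submodule K (P → K) where
  carrier := {c | (X.gr '' {p | c p ≠ 0}).Finite ∧ ∀ C : ℝ, {p | c p ≠ 0 ∧ C < X.action p}.Finite}
  zero_mem' := by simp
  add_mem' := by
    rintro a b ⟨ha, ha'⟩ ⟨hb, hb'⟩
    have key : ∀ p, (a + b) p ≠ 0 → a p ≠ 0 ∨ b p ≠ 0 := by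
      intro p hp
      by_contra! h
      exact hp (by simp [h.1, h.2])
    refine ⟨(ha.union hb).subset ?_, fun C => ((ha' C).union (hb' C)).subset ?_⟩
    · rintro _ ⟨p, hp, rfl⟩
      rcases key p hp with h | h
      · exact Or.inl ⟨p, h, rfl⟩
      · exact Or.inr ⟨p, h, rfl⟩
    · rintro p ⟨hp, hC⟩
      rcases key p hp with h | h
      · exact Or.inl ⟨h, hC⟩
      · exact Or.inr ⟨h, hC⟩
  smul_mem' := by
    rintro r a ⟨ha, ha'⟩
    have key : ∀ p, (r • a) p ≠ 0 → a p ≠ 0 := by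
      intro p hp h
      exact hp (by simp [h])
    refine ⟨ha.subset ?_, fun C => (ha' C).subset ?_⟩
    · rintro _ ⟨p, hp, rfl⟩
      exact ⟨p, key p hp, rfl⟩
    · rintro p ⟨hp, hC⟩
      exact ⟨key p hp, hC⟩

/-- The degree-`k` part `Cₖ`: formal sums of generators of grading `k`. -/
def graded (k : ℤ) : Submodule K (X.chains K) where
  carrier := {c | ∀ p, c.1 p ≠ 0 → X.gr p = k}
  zero_mem' := by simp
  add_mem' := by
    intro a b ha hb p hp
    by_cases h : a.1 p = 0
    · refine hb p fun h' => hp ?_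
      simp [h, h']
    · exact ha p h
  smul_mem' := by
    intro r a ha p hp
    exact ha p fun h => hp (by simp [h])

/-- The full Novikov ring `⨁ₙ eⁿ Λ`, as a `K`-vector space: formal sums `∑ a_g g` over `Γ` involving
finitely many degrees such that for each real `C` only finitely many `g` with `a_g ≠ 0` have period
`< C`. -/
def novikov : Submodule K (Γ → K) where
  carrier := {a | (X.deg '' {g | a g ≠ 0}).Finite ∧ ∀ C : ℝ, {g | a g ≠ 0 ∧ X.period g < C}.Finite}
  zero_mem' := by simp
  add_mem' := by
    rintro a b ⟨ha, ha'⟩ ⟨hb, hb'⟩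
    have key : ∀ p, (a + b) p ≠ 0 → a p ≠ 0 ∨ b p ≠ 0 := by
      intro p hp
      by_contra! h
      exact hp (by simp [h.1, h.2])
    refine ⟨(ha.union hb).subset ?_, fun C => ((ha' C).union (hb' C)).subset ?_⟩
    · rintro _ ⟨p, hp, rfl⟩
      rcases key p hp with h | h
      · exact Or.inl ⟨p, h, rfl⟩
      · exact Or.inr ⟨p, h, rfl⟩
    · rintro p ⟨hp, hC⟩
      rcases key p hp with h | h
      · exact Or.inl ⟨h, hC⟩
      · exact Or.inr ⟨h, hC⟩
  smul_mem' := by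
    rintro r a ⟨ha, ha'⟩
    have key : ∀ p, (r • a) p ≠ 0 → a p ≠ 0 := by
      intro p hp h
      exact hp (by simp [h])
    refine ⟨ha.subset ?_, fun C => (ha' C).subset ?_⟩
    · rintro _ ⟨p, hp, rfl⟩
      exact ⟨p, key p hp, rfl⟩
    · rintro p ⟨hp, hC⟩
      exact ⟨key p hp, hC⟩

variable {K}

theorem chains_bdd (c : X.chains K) : ∃ M : ℝ, ∀ p, c.1 p ≠ 0 → X.action p ≤ M := by
  obtain ⟨M, hM⟩ := ((c.2.2 0).image X.action).bddAbove
  refine ⟨max M 0, fun p hp => ?_⟩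
  by_cases h : 0 < X.action p
  · exact le_max_of_le_left (hM ⟨p, ⟨hp, h⟩, rfl⟩)
  · exact le_max_of_le_right (not_lt.mp h)

theorem novikov_bdd (a : X.novikov K) : ∃ m : ℝ, ∀ g, a.1 g ≠ 0 → m ≤ X.period g := by
  obtain ⟨M, hM⟩ := ((a.2.2 0).image X.period).bddBelow
  refine ⟨min M 0, fun p hp => ?_⟩
  by_cases h : X.period p < 0
  · exact min_le_of_left_le (hM ⟨p, ⟨hp, h⟩, rfl⟩)
  · exact min_le_of_right_le (not_lt.mp h)

theorem novikov_conv_finite (a : X.novikov K) (c : X.chains K) (C : ℝ) :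
    {x : Γ × P | a.1 x.1 ≠ 0 ∧ c.1 x.2 ≠ 0 ∧ C < X.action x.2 - X.period x.1}.Finite := by
  obtain ⟨M, hM⟩ := X.chains_bdd c
  obtain ⟨m, hm⟩ := X.novikov_bdd a
  refine ((a.2.2 (M - C)).prod (c.2.2 (C + m))).subset ?_
  rintro ⟨g, p⟩ ⟨h1, h2, h3⟩
  have := hM p h2
  have := hm g h1
  simp only at h3
  exact ⟨⟨h1, by linarith⟩, ⟨h2, by linarith⟩⟩

/-- The action of the Novikov ring on the Floer complex, which extends the `Γ`-action on `P`:
the coefficient of `p` in `(∑ a_g g) (∑ c_q q)` is the (finite) sum of the `a_g c_q` with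
`g q = p`. -/
noncomputable def novikovAct (a : X.novikov K) (c : X.chains K) : X.chains K :=
  ⟨fun p => ∑ᶠ g, a.1 g * c.1 (X.act g⁻¹ p), by
    have key : ∀ p, (∑ᶠ g, a.1 g * c.1 (X.act g⁻¹ p)) ≠ 0 →
        ∃ g q, a.1 g ≠ 0 ∧ c.1 q ≠ 0 ∧ X.act g q = p := by
      intro p hp
      obtain ⟨g, hg⟩ := FloerNovikovData.exists_of_finsum hp
      exact ⟨g, _, left_ne_zero_of_mul hg, right_ne_zero_of_mul hg, X.act_act_inv g p⟩
    refine ⟨((a.2.1.prod c.2.1).image (fun x => x.2 - x.1)).subset ?_, fun C =>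
      ((X.novikov_conv_finite a c C).image (fun x => X.act x.1 x.2)).subset ?_⟩
    · rintro _ ⟨p, hp, rfl⟩
      obtain ⟨g, q, hg, hq, rfl⟩ := key p hp
      exact ⟨(X.deg g, X.gr q), ⟨⟨g, hg, rfl⟩, ⟨q, hq, rfl⟩⟩, (X.gr_act g q).symm⟩
    · rintro p ⟨hp, hC⟩
      obtain ⟨g, q, hg, hq, rfl⟩ := key p hp
      exact ⟨(g, q), ⟨hg, hq, by rw [X.action_act] at hC; exact hC⟩, rfl⟩⟩

/-- `ℓ(∑ c_p p) = max {𝒜(p) | c_p ≠ 0}`, with `ℓ(0) = -∞`. -/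
noncomputable def level (c : X.chains K) : EReal :=
  sSup ((fun p => (X.action p : EReal)) '' {p | c.1 p ≠ 0})

theorem level_zero : X.level (0 : X.chains K) = ⊥ := by
  simp [level]

theorem exists_level_eq {c : X.chains K} (hc : c ≠ 0) :
    ∃ p, c.1 p ≠ 0 ∧ (∀ q, c.1 q ≠ 0 → X.action q ≤ X.action p) ∧ X.level c = X.action p := by
  have : ∃ p, c.1 p ≠ 0 := by
    by_contra! h
    exact hc (Subtype.ext (funext h))
  obtain ⟨p₀, hp₀⟩ := this
  obtain ⟨p, ⟨hp, hp1⟩, hmax⟩ := Set.exists_max_image _ X.action (c.2.2 (X.action p₀ - 1))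
    ⟨p₀, hp₀, by linarith⟩
  have hall : ∀ q, c.1 q ≠ 0 → X.action q ≤ X.action p := by
    intro q hq
    by_cases h : X.action p₀ - 1 < X.action q
    · exact hmax q ⟨hq, h⟩
    · linarith
  refine ⟨p, hp, hall, le_antisymm (sSup_le ?_) (le_sSup ⟨p, hp, rfl⟩)⟩
  rintro _ ⟨q, hq, rfl⟩
  exact EReal.coe_le_coe_iff.mpr (hall q hq)

theorem action_le_level {c : X.chains K} {p : P} (hp : c.1 p ≠ 0) :
    (X.action p : EReal) ≤ X.level c :=
  le_sSup ⟨p, hp, rfl⟩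

theorem level_lt_iff (c : X.chains K) (α : ℝ) :
    X.level c < α ↔ ∀ p, c.1 p ≠ 0 → X.action p < α := by
  constructor
  · intro h p hp
    exact EReal.coe_lt_coe_iff.mp (lt_of_le_of_lt (X.action_le_level hp) h)
  · intro h
    by_cases hc : c = 0
    · rw [hc, level_zero]
      exact EReal.bot_lt_coe α
    · obtain ⟨p, hp, -, hl⟩ := X.exists_level_eq hc
      rw [hl]
      exact EReal.coe_lt_coe_iff.mpr (h p hp)

theorem level_le_iff (c : X.chains K) (α : ℝ) :
    X.level c ≤ α ↔ ∀ p, c.1 p ≠ 0 → X.action p ≤ α := by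
  constructor
  · intro h p hp
    exact EReal.coe_le_coe_iff.mp ((X.action_le_level hp).trans h)
  · intro h
    refine sSup_le ?_
    rintro _ ⟨q, hq, rfl⟩
    exact EReal.coe_le_coe_iff.mpr (h q hq)

variable (K)

/-- `C_*^{(-∞,α)} = {c | ℓ(c) < α}`. -/
def filtLT (α : ℝ) : Submodule K (X.chains K) where
  carrier := {c | X.level c < α}
  zero_mem' := by
    change X.level 0 < _
    rw [level_zero]
    exact EReal.bot_lt_coe α
  add_mem' := by
    intro a b ha hb
    refine (X.level_lt_iff _ α).mpr fun p hp => ?_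
    by_cases h : a.1 p = 0
    · refine (X.level_lt_iff b α).mp hb p fun h' => hp ?_
      simp [h, h']
    · exact (X.level_lt_iff a α).mp ha p h
  smul_mem' := by
    intro r a ha
    refine (X.level_lt_iff _ α).mpr fun p hp => ?_
    exact (X.level_lt_iff a α).mp ha p fun h => hp (by simp [h])

/-- `C_*^{(-∞,α]} = {c | ℓ(c) ≤ α}`. -/
def filtLE (α : ℝ) : Submodule K (X.chains K) where
  carrier := {c | X.level c ≤ α}
  zero_mem' := by
    change X.level 0 ≤ _
    rw [level_zero]
    exact bot_le
  add_mem' := by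
    intro a b ha hb
    refine (X.level_le_iff _ α).mpr fun p hp => ?_
    by_cases h : a.1 p = 0
    · refine (X.level_le_iff b α).mp hb p fun h' => hp ?_
      simp [h, h']
    · exact (X.level_le_iff a α).mp ha p h
  smul_mem' := by
    intro r a ha
    refine (X.level_le_iff _ α).mpr fun p hp => ?_
    exact (X.level_le_iff a α).mp ha p fun h => hp (by simp [h])

open Classical in
/-- A point `p` of `P`, regarded as an element of `C_*`. -/
noncomputable def gen (p : P) : X.chains K :=
  ⟨Pi.single p 1, by
    have key : ∀ q, (Pi.single p 1 : P → K) q ≠ 0 → q = p := by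
      intro q hq
      by_contra h
      exact hq (Pi.single_eq_of_ne h 1)
    refine ⟨(Set.finite_singleton (X.gr p)).subset ?_,
      fun C => (Set.finite_singleton p).subset fun q hq => key q hq.1⟩
    rintro _ ⟨q, hq, rfl⟩
    rw [key q hq]
    rfl⟩

end Chains

/-- The data of the opposite complex: `Γ` acts through inverses, the action functional and the
grading are negated, the period and degree homomorphisms are unchanged. -/
def op : FloerNovikovData Γ P S where
  fg := X.fg
  finite_base := X.finite_base
  act g p := X.act g⁻¹ p
  one_act p := by rw [inv_one, X.one_act]
  mul_act g h p := by rw [mul_inv, X.mul_act]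
  free g p h := inv_eq_one.mp (X.free _ _ h)
  proj := X.proj
  proj_surjective := X.proj_surjective
  proj_eq_iff p q := by
    rw [X.proj_eq_iff]
    exact ⟨fun ⟨g, hg⟩ => ⟨g⁻¹, by rwa [inv_inv]⟩, fun ⟨g, hg⟩ => ⟨g⁻¹, hg⟩⟩
  action p := - X.action p
  period := X.period
  period_mul := X.period_mul
  action_act g p := by rw [X.action_act, X.period_inv]; ring
  gr p := - X.gr p
  deg := X.deg
  deg_mul := X.deg_mul
  gr_act g p := by rw [X.gr_act, X.deg_inv]; ring

theorem op_finite {K : Type*} [Field K] (d : X.op.chains K) (C : ℝ) :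
    {p | d.1 p ≠ 0 ∧ X.action p < C}.Finite := by
  refine (d.2.2 (-C)).subset ?_
  rintro p ⟨h1, h2⟩
  exact ⟨h1, neg_lt_neg h2⟩

theorem op_bdd {K : Type*} [Field K] (d : X.op.chains K) :
    ∃ m : ℝ, ∀ p, d.1 p ≠ 0 → m ≤ X.action p := by
  obtain ⟨M, hM⟩ := X.op.chains_bdd d
  exact ⟨-M, fun p hp => neg_le.mp (hM p hp)⟩

theorem pairing_finite {K : Type*} [Field K] (d : X.op.chains K) (c : X.chains K) :
    (Function.support fun p => d.1 p * c.1 p).Finite := by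
  obtain ⟨m, hm⟩ := X.op_bdd d
  refine (c.2.2 (m - 1)).subset ?_
  intro p hp
  have := hm p (left_ne_zero_of_mul hp)
  exact ⟨right_ne_zero_of_mul hp, by linarith⟩

/-- The pairing `Δ : D_* × C_* → K`, `Δ(∑ d_p p, ∑ c_q q) = ∑ d_p c_p` (a finite sum). -/
noncomputable def pairing (K : Type*) [Field K] : X.op.chains K →ₗ[K] X.chains K →ₗ[K] K :=
  LinearMap.mk₂ K (fun d c => ∑ᶠ p, d.1 p * c.1 p)
    (by
      intro d d' c
      rw [← finsum_add_distrib (X.pairing_finite d c) (X.pairing_finite d' c)]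
      exact finsum_congr fun p => add_mul _ _ _)
    (by
      intro r d c
      rw [smul_eq_mul, mul_finsum]
      exact finsum_congr fun p => mul_assoc _ _ _)
    (by
      intro d c c'
      rw [← finsum_add_distrib (X.pairing_finite d c) (X.pairing_finite d c')]
      exact finsum_congr fun p => mul_add _ _ _)
    (by
      intro r d c
      rw [smul_eq_mul, mul_finsum]
      exact finsum_congr fun p => mul_left_comm _ _ _)

theorem pairing_apply {K : Type*} [Field K] (d : X.op.chains K) (c : X.chains K) :
    X.pairing K d c = ∑ᶠ p, d.1 p * c.1 p := rfl

/-- `Δ` vanishes on `D_*^{(-∞,-α)} × C_*^{(-∞,α]}`. -/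
theorem pairing_filt {K : Type*} [Field K] (α : ℝ) {d : X.op.chains K} {c : X.chains K}
    (hd : d ∈ X.op.filtLT K (-α)) (hc : c ∈ X.filtLE K α) : X.pairing K d c = 0 := by
  rw [pairing_apply]
  refine (finsum_congr fun p => ?_).trans finsum_zero
  by_contra h
  have h1 : -X.action p < -α := (X.op.level_lt_iff d (-α)).mp hd p (left_ne_zero_of_mul h)
  have h2 := (X.level_le_iff c α).mp hc p (right_ne_zero_of_mul h)
  linarith

theorem finsum_swap {α β K : Type*} [Field K] (f : α → β → K)
    (h : {x : α × β | f x.1 x.2 ≠ 0}.Finite) :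
    ∑ᶠ a, ∑ᶠ b, f a b = ∑ᶠ b, ∑ᶠ a, f a b := by
  have h' : {x : β × α | f x.2 x.1 ≠ 0}.Finite := by
    refine (h.image Prod.swap).subset ?_
    rintro ⟨b, a⟩ hx
    exact ⟨(a, b), hx, rfl⟩
  rw [← finsum_curry (fun x : α × β => f x.1 x.2) h,
    ← finsum_curry (fun x : β × α => f x.2 x.1) h']
  exact (finsum_comp_equiv (Equiv.prodComm β α) (f := fun x : α × β => f x.1 x.2)).symm

end FloerNovikovData

/-- A graded filtered Floer--Novikov complex over the field `K`.  The boundary operator is an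
endomorphism of the Floer complex as a module over the full Novikov ring. -/
structure FloerNovikovComplex (K Γ P S : Type*) [Field K] [CommGroup Γ] extends
    FloerNovikovData Γ P S where
  bd : toFloerNovikovData.chains K →ₗ[K] toFloerNovikovData.chains K
  bd_novikovAct : ∀ (a : toFloerNovikovData.novikov K) (c : toFloerNovikovData.chains K),
    bd (toFloerNovikovData.novikovAct a c) = toFloerNovikovData.novikovAct a (bd c)
  bd_bd : ∀ c, bd (bd c) = 0
  level_bd : ∀ c, c ≠ 0 → toFloerNovikovData.level (bd c) < toFloerNovikovData.level c
  bd_graded : ∀ k, ∀ c ∈ toFloerNovikovData.graded K k, bd c ∈ toFloerNovikovData.graded K (k - 1)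

namespace FloerNovikovComplex

variable {K Γ P S : Type*} [Field K] [CommGroup Γ] (X : FloerNovikovComplex K Γ P S)

/-- The coefficients `n(p,q)`, where `∂p = ∑ n(p,q) q`. -/
noncomputable def coeff (p q : P) : K := (X.bd (X.gen K p)).1 q

theorem gen_self (p : P) : (X.gen K p).1 p = 1 := by
  classical
  exact Pi.single_eq_same p 1

theorem gen_ne {p q : P} (h : q ≠ p) : (X.gen K p).1 q = 0 := by
  classical
  exact Pi.single_eq_of_ne h 1

theorem gen_ne_zero (p : P) : X.gen K p ≠ 0 := by
  intro h
  have h1 := X.gen_self p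
  rw [h] at h1
  exact zero_ne_one h1

theorem action_lt_of_coeff {p q : P} (h : X.coeff p q ≠ 0) : X.action q < X.action p := by
  have h1 : X.level (X.gen K p) = X.action p := by
    obtain ⟨r, hr, -, hl⟩ := X.exists_level_eq (X.gen_ne_zero p)
    rw [hl]
    by_cases hrp : r = p
    · rw [hrp]
    · exact absurd (X.gen_ne hrp) hr
  have h2 := X.level_bd _ (X.gen_ne_zero p)
  rw [h1] at h2
  exact (X.level_lt_iff _ _).mp h2 q h

theorem gr_of_coeff {p q : P} (h : X.coeff p q ≠ 0) : X.gr q = X.gr p - 1 := by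
  refine X.bd_graded (X.gr p) (X.gen K p) ?_ q h
  intro r hr
  by_cases hrp : r = p
  · rw [hrp]
  · exact absurd (X.gen_ne hrp) hr

open Classical in
/-- A group element, regarded as an element of the Novikov ring. -/
noncomputable def novGen (g : Γ) : X.novikov K :=
  ⟨Pi.single g 1, by
    have key : ∀ q, (Pi.single g 1 : Γ → K) q ≠ 0 → q = g := by
      intro q hq
      by_contra h
      exact hq (Pi.single_eq_of_ne h 1)
    refine ⟨(Set.finite_singleton (X.deg g)).subset ?_,
      fun C => (Set.finite_singleton g).subset fun q hq => key q hq.1⟩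
    rintro _ ⟨q, hq, rfl⟩
    rw [key q hq]
    rfl⟩

theorem novGen_act (g : Γ) (c : X.chains K) (p : P) :
    (X.novikovAct (X.novGen g) c).1 p = c.1 (X.act g⁻¹ p) := by
  classical
  change ∑ᶠ h, (Pi.single g 1 : Γ → K) h * c.1 (X.act h⁻¹ p) = _
  rw [finsum_eq_single _ g]
  · rw [Pi.single_eq_same, one_mul]
  · intro h hh
    rw [Pi.single_eq_of_ne hh, zero_mul]

theorem novGen_gen (g : Γ) (p : P) :
    X.novikovAct (X.novGen g) (X.gen K p) = X.gen K (X.act g p) := by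
  refine Subtype.ext (funext fun q => ?_)
  rw [novGen_act]
  by_cases h : q = X.act g p
  · rw [h, X.act_inv_act, gen_self, gen_self]
  · rw [X.gen_ne h, X.gen_ne]
    intro h'
    exact h (by rw [← h', X.act_act_inv])

theorem coeff_act (g : Γ) (p q : P) : X.coeff (X.act g p) (X.act g q) = X.coeff p q := by
  unfold coeff
  rw [← novGen_gen, X.bd_novikovAct, novGen_act, X.act_inv_act]

theorem bd_apply_finite (c : X.chains K) (q : P) :
    (Function.support fun p => c.1 p * X.coeff p q).Finite := by
  refine (c.2.2 (X.action q)).subset ?_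
  intro p hp
  exact ⟨left_ne_zero_of_mul hp, X.action_lt_of_coeff (right_ne_zero_of_mul hp)⟩

/-- `∂(∑ c_p p) = ∑_q (∑_p c_p n(p,q)) q`. -/
theorem bd_apply (c : X.chains K) (q : P) :
    (X.bd c).1 q = ∑ᶠ p, c.1 p * X.coeff p q := by
  classical
  have := X.finite_base
  have := Fintype.ofFinite S
  choose σ hσ using X.proj_surjective
  let a : S → X.novikov K := fun s => ⟨fun g => c.1 (X.act g (σ s)), by
    refine ⟨((c.2.1).image fun k => X.gr (σ s) - k).subset ?_, fun C => ?_⟩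
    · rintro _ ⟨g, hg, rfl⟩
      refine ⟨_, ⟨_, hg, rfl⟩, ?_⟩
      simp only [X.gr_act]
      ring
    · refine ((c.2.2 (X.action (σ s) - C)).preimage
        (X.act_left_injective (σ s)).injOn).subset ?_
      rintro g ⟨h1, h2⟩
      refine ⟨h1, ?_⟩
      rw [X.action_act]
      linarith⟩
  have hproj : ∀ g p, X.proj (X.act g p) = X.proj p := fun g p =>
    ((X.proj_eq_iff p _).mpr ⟨g, rfl⟩).symm
  let e : S × Γ ≃ P := Equiv.ofBijective (fun x => X.act x.2 (σ x.1)) (by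
    constructor
    · rintro ⟨s, g⟩ ⟨t, h⟩ hx
      have hx' : X.act g (σ s) = X.act h (σ t) := hx
      have hst : s = t := by
        have := congrArg X.proj hx'
        rwa [hproj, hproj, hσ, hσ] at this
      subst hst
      rw [X.act_left_injective (σ s) hx']
    · intro p
      obtain ⟨g, hg⟩ := (X.proj_eq_iff (σ (X.proj p)) p).mp (hσ _)
      exact ⟨(X.proj p, g), hg⟩)
  have hval : ∀ s (b : X.chains K) r, (X.novikovAct (a s) b).1 r =
      ∑ᶠ g, c.1 (X.act g (σ s)) * b.1 (X.act g⁻¹ r) := fun _ _ _ => rfl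
  have hcoe : ∀ (f : S → X.chains K) r, (∑ s, f s).1 r = ∑ s, (f s).1 r := by
    intro f r
    have : (∑ s, f s).1 = ∑ s, (f s).1 := Submodule.coe_sum _ _ _
    rw [this, Finset.sum_apply]
  have hsum : ∀ F : P → K, (Function.support F).Finite →
      ∑ᶠ p, F p = ∑ s, ∑ᶠ g, F (X.act g (σ s)) := by
    intro F hF
    rw [← finsum_comp_equiv e, finsum_curry, finsum_eq_sum_of_fintype]
    · rfl
    · exact hF.preimage e.injective.injOn
  have hc : c = ∑ s, X.novikovAct (a s) (X.gen K (σ s)) := by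
    refine Subtype.ext (funext fun r => ?_)
    rw [hcoe]
    have h1 : c.1 r = ∑ᶠ p, c.1 p * (X.gen K p).1 r := by
      rw [finsum_eq_single _ r, gen_self, mul_one]
      intro p hp
      rw [X.gen_ne hp.symm, mul_zero]
    rw [h1, hsum]
    · refine Finset.sum_congr rfl fun s _ => ?_
      rw [hval]
      refine finsum_congr fun g => ?_
      rw [← novGen_gen, novGen_act]
    · refine (Set.finite_singleton r).subset ?_
      intro p hp
      by_contra h
      exact right_ne_zero_of_mul hp (X.gen_ne (Ne.symm h))
  conv_lhs => rw [hc]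
  rw [map_sum, hcoe, hsum _ (X.bd_apply_finite c q)]
  refine Finset.sum_congr rfl fun s _ => ?_
  rw [X.bd_novikovAct, hval]
  refine finsum_congr fun g => ?_
  have := X.coeff_act g (σ s) (X.act g⁻¹ q)
  rw [X.act_act_inv] at this
  rw [this]
  rfl

theorem coeff_finite (p : P) (C : ℝ) : {q | X.coeff q p ≠ 0 ∧ X.action q < C}.Finite := by
  have := X.finite_base
  choose σ hσ using X.proj_surjective
  have key : ∀ s, {g | X.coeff (X.act g (σ s)) p ≠ 0 ∧ X.action (X.act g (σ s)) < C}.Finite := by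
    intro s
    have hinj : Function.Injective fun g => X.act g⁻¹ p :=
      (X.act_left_injective p).comp inv_injective
    refine (((X.bd (X.gen K (σ s))).2.2 (X.action p + X.action (σ s) - C)).preimage
      hinj.injOn).subset ?_
    rintro g ⟨h1, h2⟩
    have h3 := X.coeff_act g (σ s) (X.act g⁻¹ p)
    rw [X.act_act_inv] at h3
    rw [h3] at h1
    refine ⟨h1, ?_⟩
    rw [X.action_act] at h2
    rw [X.action_act, X.period_inv]
    linarith
  refine (Set.finite_iUnion fun s => (key s).image fun g => X.act g (σ s)).subset ?_
  rintro q hq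
  obtain ⟨g, hg⟩ := (X.proj_eq_iff (σ (X.proj q)) q).mp (hσ _)
  refine Set.mem_iUnion.mpr ⟨X.proj q, g, ?_, hg⟩
  change X.coeff (X.act g _) p ≠ 0 ∧ X.action (X.act g _) < C
  rw [hg]
  exact hq

theorem delta_finite (d : X.op.chains K) (q : P) :
    (Function.support fun p => d.1 p * X.coeff q p).Finite :=
  X.pairing_finite d (X.bd (X.gen K q))

/-- The boundary operator of the opposite complex: `δp = ∑ n(q,p) q`, so that
`δ(∑ d_p p) = ∑_q (∑_p d_p n(q,p)) q`. -/
noncomputable def delta : X.op.chains K →ₗ[K] X.op.chains K where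
  toFun d := ⟨fun q => ∑ᶠ p, d.1 p * X.coeff q p, by
    have key : ∀ q, (∑ᶠ p, d.1 p * X.coeff q p) ≠ 0 → ∃ p, d.1 p ≠ 0 ∧ X.coeff q p ≠ 0 := by
      intro q hq
      obtain ⟨p, hp⟩ := FloerNovikovData.exists_of_finsum hq
      exact ⟨p, left_ne_zero_of_mul hp, right_ne_zero_of_mul hp⟩
    refine ⟨(d.2.1.image fun k => k - 1).subset ?_, fun C => ?_⟩
    · rintro _ ⟨q, hq, rfl⟩
      obtain ⟨p, hp, hn⟩ := key q hq
      refine ⟨_, ⟨p, hp, rfl⟩, ?_⟩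
      change - X.gr p - 1 = - X.gr q
      rw [X.gr_of_coeff hn]
      ring
    · refine ((X.op_finite d (-C)).biUnion fun p _ => X.coeff_finite p (-C)).subset ?_
      rintro q ⟨hq, hC⟩
      obtain ⟨p, hp, hn⟩ := key q hq
      have hC' : X.action q < -C := lt_neg_of_lt_neg hC
      have := X.action_lt_of_coeff hn
      exact Set.mem_biUnion (show p ∈ {p | d.1 p ≠ 0 ∧ X.action p < -C} from
        ⟨hp, this.trans hC'⟩) ⟨hn, hC'⟩⟩
  map_add' d d' := by
    refine Subtype.ext (funext fun q => ?_)
    change ∑ᶠ p, (d.1 p + d'.1 p) * X.coeff q p =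
      ∑ᶠ p, d.1 p * X.coeff q p + ∑ᶠ p, d'.1 p * X.coeff q p
    rw [← finsum_add_distrib (X.delta_finite d q) (X.delta_finite d' q)]
    exact finsum_congr fun p => add_mul _ _ _
  map_smul' r d := by
    refine Subtype.ext (funext fun q => ?_)
    change ∑ᶠ p, (r * d.1 p) * X.coeff q p = r * ∑ᶠ p, d.1 p * X.coeff q p
    rw [mul_finsum]
    exact finsum_congr fun p => mul_assoc _ _ _

theorem delta_apply (d : X.op.chains K) (q : P) :
    (X.delta d).1 q = ∑ᶠ p, d.1 p * X.coeff q p := rfl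

/-- `Δ(δd, c) = Δ(d, ∂c)`. -/
theorem pairing_delta (d : X.op.chains K) (c : X.chains K) :
    X.pairing K (X.delta d) c = X.pairing K d (X.bd c) := by
  rw [X.pairing_apply, X.pairing_apply]
  have h1 : ∀ q, (X.delta d).1 q * c.1 q = ∑ᶠ p, d.1 p * X.coeff q p * c.1 q := by
    intro q
    rw [delta_apply, finsum_mul]
  have h2 : ∀ p, d.1 p * (X.bd c).1 p = ∑ᶠ q, d.1 p * X.coeff q p * c.1 q := by
    intro p
    rw [bd_apply, mul_finsum]
    exact finsum_congr fun q => by ring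
  rw [finsum_congr h1, finsum_congr h2]
  refine FloerNovikovData.finsum_swap (fun q p => d.1 p * X.coeff q p * c.1 q) ?_
  obtain ⟨m, hm⟩ := X.op_bdd d
  obtain ⟨M, hM⟩ := X.chains_bdd c
  refine ((c.2.2 m).prod (X.op_finite d M)).subset ?_
  rintro ⟨q, p⟩ hx
  have hc : c.1 q ≠ 0 := right_ne_zero_of_mul hx
  have hd : d.1 p ≠ 0 := left_ne_zero_of_mul (left_ne_zero_of_mul hx)
  have hn := X.action_lt_of_coeff (right_ne_zero_of_mul (left_ne_zero_of_mul hx))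
  have := hm p hd
  have := hM q hc
  exact ⟨⟨hc, by simp only; linarith⟩, ⟨hd, by simp only; linarith⟩⟩

theorem delta_novikovAct (a : X.op.novikov K) (d : X.op.chains K) :
    X.delta (X.op.novikovAct a d) = X.op.novikovAct a (X.delta d) := by
  refine Subtype.ext (funext fun q => ?_)
  have hact : ∀ (b : X.op.chains K) r,
      (X.op.novikovAct a b).1 r = ∑ᶠ g, a.1 g * b.1 (X.act g r) := by
    intro b r
    refine finsum_congr fun g => ?_
    change a.1 g * b.1 (X.act g⁻¹⁻¹ r) = _
    rw [inv_inv]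
  rw [hact, delta_apply]
  have hF : {x : P × Γ | a.1 x.2 * d.1 (X.act x.2 x.1) * X.coeff q x.1 ≠ 0}.Finite := by
    have hfin := X.op.novikov_conv_finite a d (- X.action q)
    refine (hfin.image fun x => (X.act x.1⁻¹ x.2, x.1)).subset ?_
    rintro ⟨p, g⟩ hx
    have h1 : a.1 g ≠ 0 := left_ne_zero_of_mul (left_ne_zero_of_mul hx)
    have h2 : d.1 (X.act g p) ≠ 0 := right_ne_zero_of_mul (left_ne_zero_of_mul hx)
    have h3 := X.action_lt_of_coeff (right_ne_zero_of_mul hx)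
    refine ⟨(g, X.act g p), ⟨h1, h2, ?_⟩, by simp only [X.act_inv_act]⟩
    change - X.action q < - X.action (X.act g p) - X.period g
    rw [X.action_act]
    simp only at h3
    linarith
  have h1 : ∀ p, (X.op.novikovAct a d).1 p * X.coeff q p =
      ∑ᶠ g, a.1 g * d.1 (X.act g p) * X.coeff q p := by
    intro p
    rw [hact]
    rw [finsum_mul]
  rw [finsum_congr h1, FloerNovikovData.finsum_swap _ hF]
  refine finsum_congr fun g => ?_
  rw [delta_apply, mul_finsum]
  let e : P ≃ P := ⟨X.act g, X.act g⁻¹, X.act_inv_act g, X.act_act_inv g⟩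
  refine Eq.trans ?_ (finsum_comp_equiv e)
  refine finsum_congr fun p => ?_
  change _ = a.1 g * (d.1 (X.act g p) * X.coeff (X.act g q) (X.act g p))
  rw [coeff_act, mul_assoc]

theorem delta_delta (d : X.op.chains K) : X.delta (X.delta d) = 0 := by
  refine Subtype.ext (funext fun q => ?_)
  have h : (X.delta (X.delta d)).1 q = X.pairing K (X.delta d) (X.bd (X.gen K q)) := rfl
  rw [h, pairing_delta, X.bd_bd, map_zero]
  rfl

theorem exists_of_delta {d : X.op.chains K} {q : P} (h : (X.delta d).1 q ≠ 0) :
    ∃ p, d.1 p ≠ 0 ∧ X.coeff q p ≠ 0 := by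
  rw [delta_apply] at h
  obtain ⟨p, hp⟩ := FloerNovikovData.exists_of_finsum h
  exact ⟨p, left_ne_zero_of_mul hp, right_ne_zero_of_mul hp⟩

/-- The opposite complex. -/
noncomputable def op : FloerNovikovComplex K Γ P S where
  toFloerNovikovData := X.toFloerNovikovData.op
  bd := X.delta
  bd_novikovAct := X.delta_novikovAct
  bd_bd := X.delta_delta
  level_bd d hd := by
    obtain ⟨r, hr, hmax, hl⟩ := X.toFloerNovikovData.op.exists_level_eq hd
    rw [hl, FloerNovikovData.level_lt_iff]
    intro q hq
    obtain ⟨p, hp, hn⟩ := X.exists_of_delta hq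
    exact lt_of_lt_of_le (neg_lt_neg (X.action_lt_of_coeff hn)) (hmax p hp)
  bd_graded k d hd q hq := by
    obtain ⟨p, hp, hn⟩ := X.exists_of_delta hq
    have h1 : - X.gr p = k := hd p hp
    have h2 := X.gr_of_coeff hn
    change - X.gr q = k - 1
    linarith

/-- `δp = ∑ n(q,p) q`. -/
theorem op_coeff (p q : P) : X.op.coeff p q = X.coeff q p := by
  change ∑ᶠ r, (X.op.gen K p).1 r * X.coeff q r = _
  rw [finsum_eq_single _ p, X.op.gen_self, one_mul]
  intro r hr
  rw [X.op.gen_ne hr, zero_mul]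

theorem bd_filtLT (α : ℝ) : ∀ c ∈ X.filtLT K α, X.bd c ∈ X.filtLT K α := by
  intro c hc
  by_cases h : c = 0
  · rw [h, map_zero]
    exact zero_mem _
  · exact (X.level_bd c h).trans hc

theorem bd_filtLE (α : ℝ) : ∀ c ∈ X.filtLE K α, X.bd c ∈ X.filtLE K α := by
  intro c hc
  by_cases h : c = 0
  · rw [h, map_zero]
    exact zero_mem _
  · exact (X.level_bd c h).le.trans hc

end FloerNovikovComplex

section Homology

variable {K V W : Type*} [Field K] [AddCommGroup V] [Module K V] [AddCommGroup W] [Module K W]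

/-- The degree-`k` cycles of a chain complex whose underlying vector space is `V`, with degree-`j`
part `G j` and boundary operator `f`. -/
def gradedCycles (G : ℤ → Submodule K V) (f : V →ₗ[K] V) (k : ℤ) : Submodule K V :=
  G k ⊓ LinearMap.ker f

/-- The degree-`k` homology of a chain complex whose underlying vector space is `V`, with degree-`j`
part `G j` and boundary operator `f`: the degree-`k` cycles modulo the boundaries of chains of
degree `k + 1`. -/
def GradedHomology (G : ℤ → Submodule K V) (f : V →ₗ[K] V) (k : ℤ) : Type _ :=
  ↥(gradedCycles G f k) ⧸ ((G (k + 1)).map f).submoduleOf (gradedCycles G f k)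

noncomputable instance (G : ℤ → Submodule K V) (f : V →ₗ[K] V) (k : ℤ) :
    AddCommGroup (GradedHomology G f k) :=
  inferInstanceAs (AddCommGroup (_ ⧸ ((G (k + 1)).map f).submoduleOf (gradedCycles G f k)))

noncomputable instance (G : ℤ → Submodule K V) (f : V →ₗ[K] V) (k : ℤ) :
    Module K (GradedHomology G f k) :=
  inferInstanceAs (Module K (_ ⧸ ((G (k + 1)).map f).submoduleOf (gradedCycles G f k)))

/-- The homology class of a cycle. -/
noncomputable def gradedClass (G : ℤ → Submodule K V) (f : V →ₗ[K] V) (k : ℤ) :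
    gradedCycles G f k →ₗ[K] GradedHomology G f k :=
  (((G (k + 1)).map f).submoduleOf (gradedCycles G f k)).mkQ

/-- A bilinear pairing for which two boundary operators `f` and `g` are adjoint descends to
homology, by pairing representing cycles. -/
noncomputable def gradedHomologyPairing (G : ℤ → Submodule K V) (f : V →ₗ[K] V) (G' : ℤ → Submodule K W)
    (g : W →ₗ[K] W) (B : V →ₗ[K] W →ₗ[K] K) (hB : ∀ v w, B (f v) w = B v (g w)) (j k : ℤ) :
    GradedHomology G f j →ₗ[K] GradedHomology G' g k →ₗ[K] K :=
  Submodule.liftQ (((G (j + 1)).map f).submoduleOf (gradedCycles G f j))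
    (Submodule.liftQ (((G' (k + 1)).map g).submoduleOf (gradedCycles G' g k))
      (B.domRestrict₁₂ (gradedCycles G f j) (gradedCycles G' g k)).flip (by
        rintro ⟨c, hc⟩ ⟨b, -, hb⟩
        refine LinearMap.mem_ker.mpr (LinearMap.ext fun d => ?_)
        change B d.1 c = 0
        have hb' : g b = c := hb
        rw [← hb', ← hB, LinearMap.mem_ker.mp d.2.2, map_zero]
        rfl)).flip (by
    rintro ⟨d, hd⟩ ⟨x, -, hx⟩
    refine LinearMap.mem_ker.mpr (LinearMap.ext fun c => ?_)
    obtain ⟨c, rfl⟩ := Submodule.mkQ_surjective _ c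
    change B d c.1 = 0
    have hx' : f x = d := hx
    rw [← hx', hB, LinearMap.mem_ker.mp c.2.2, map_zero])

theorem gradedHomologyPairing_mk (G : ℤ → Submodule K V) (f : V →ₗ[K] V) (G' : ℤ → Submodule K W)
    (g : W →ₗ[K] W) (B : V →ₗ[K] W →ₗ[K] K) (hB : ∀ v w, B (f v) w = B v (g w)) (j k : ℤ)
    (d : gradedCycles G f j) (c : gradedCycles G' g k) :
    gradedHomologyPairing G f G' g B hB j k (gradedClass G f j d) (gradedClass G' g k c) =
      B d.1 c.1 := rfl

end Homology

namespace FloerNovikovComplex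

variable {K Γ P S : Type*} [Field K] [CommGroup Γ] (X : FloerNovikovComplex K Γ P S)

/-- `C_*^{(-∞,α)}`, as a vector space. -/
def SubLT (α : ℝ) : Type _ := ↥(X.filtLT K α)

instance (α : ℝ) : AddCommGroup (X.SubLT α) := inferInstanceAs (AddCommGroup ↥(X.filtLT K α))

instance (α : ℝ) : Module K (X.SubLT α) := inferInstanceAs (Module K ↥(X.filtLT K α))

/-- The inclusion of `C_*^{(-∞,α)}` into `C_*`. -/
def inclLT (α : ℝ) : X.SubLT α →ₗ[K] X.chains K := (X.filtLT K α).subtype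

/-- The boundary operator of the subcomplex `C_*^{(-∞,α)}`. -/
noncomputable def bdLT (α : ℝ) : X.SubLT α →ₗ[K] X.SubLT α :=
  X.bd.restrict (X.bd_filtLT α)

/-- The degree-`k` part of `C_*^{(-∞,α)}`. -/
def gradedLT (α : ℝ) (k : ℤ) : Submodule K (X.SubLT α) :=
  (X.graded K k).comap (X.inclLT α)

/-- `C_*^{(α,∞)} = C_* / C_*^{(-∞,α]}`. -/
def QuotGT (α : ℝ) : Type _ := X.chains K ⧸ X.filtLE K α

instance (α : ℝ) : AddCommGroup (X.QuotGT α) :=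
  inferInstanceAs (AddCommGroup (X.chains K ⧸ X.filtLE K α))

instance (α : ℝ) : Module K (X.QuotGT α) :=
  inferInstanceAs (Module K (X.chains K ⧸ X.filtLE K α))

/-- The projection of `C_*` onto `C_*^{(α,∞)}`. -/
def projGT (α : ℝ) : X.chains K →ₗ[K] X.QuotGT α := (X.filtLE K α).mkQ

theorem projGT_surjective (α : ℝ) : Function.Surjective (X.projGT α) :=
  (X.filtLE K α).mkQ_surjective

/-- The boundary operator of the quotient complex `C_*^{(α,∞)}`. -/
noncomputable def bdGT (α : ℝ) : X.QuotGT α →ₗ[K] X.QuotGT α :=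
  (X.filtLE K α).mapQ (X.filtLE K α) X.bd (X.bd_filtLE α)

/-- The degree-`k` part of `C_*^{(α,∞)}`. -/
def gradedGT (α : ℝ) (k : ℤ) : Submodule K (X.QuotGT α) :=
  (X.graded K k).map (X.projGT α)

/-- `Hₖ(C_*^{(-∞,α)})`. -/
abbrev HomologyLT (α : ℝ) (k : ℤ) : Type _ := GradedHomology (X.gradedLT α) (X.bdLT α) k

/-- `Hₖ(C_*^{(α,∞)})`. -/
abbrev HomologyGT (α : ℝ) (k : ℤ) : Type _ := GradedHomology (X.gradedGT α) (X.bdGT α) k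

/-- The pairing `Δ : D_* × C_* → K`, with `D_*` the Floer complex of the opposite complex. -/
noncomputable def pairingOp : X.op.chains K →ₗ[K] X.chains K →ₗ[K] K := X.pairing K

/-- The pairing `Δ_α : D_*^{(-∞,-α)} × C_*^{(α,∞)} → K` induced by `Δ`. -/
noncomputable def pairingFilt (α : ℝ) : X.op.SubLT (-α) →ₗ[K] X.QuotGT α →ₗ[K] K :=
  ((X.filtLE K α).liftQ (X.pairingOp.comp (X.op.inclLT (-α))).flip (by
      intro c hc
      refine LinearMap.mem_ker.mpr (LinearMap.ext fun d => ?_)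
      exact X.pairing_filt α d.2 hc)).flip

theorem pairingFilt_proj (α : ℝ) (d : X.op.SubLT (-α)) (c : X.chains K) :
    X.pairingFilt α d (X.projGT α c) = X.pairingOp (X.op.inclLT (-α) d) c := rfl

theorem inclLT_bdLT (α : ℝ) (c : X.SubLT α) : X.inclLT α (X.bdLT α c) = X.bd (X.inclLT α c) := rfl

theorem bdGT_projGT (α : ℝ) (c : X.chains K) : X.bdGT α (X.projGT α c) = X.projGT α (X.bd c) := rfl

theorem pairingFilt_bd (α : ℝ) (d : X.op.SubLT (-α)) (c : X.QuotGT α) :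
    X.pairingFilt α (X.op.bdLT (-α) d) c = X.pairingFilt α d (X.bdGT α c) := by
  obtain ⟨c, rfl⟩ := X.projGT_surjective α c
  rw [bdGT_projGT, pairingFilt_proj, pairingFilt_proj, inclLT_bdLT]
  exact X.pairing_delta _ c

/-- The homological pairing `H₋ₖ(D_*^{(-∞,-α)}) × Hₖ(C_*^{(α,∞)}) → K` induced by `Δ_α` on
representing cycles. -/
noncomputable def homologyPairing (α : ℝ) (k : ℤ) :
    X.op.HomologyLT (-α) (-k) →ₗ[K] X.HomologyGT α k →ₗ[K] K :=
  gradedHomologyPairing (X.op.gradedLT (-α)) (X.op.bdLT (-α)) (X.gradedGT α) (X.bdGT α)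
    (X.pairingFilt α) (X.pairingFilt_bd α) (-k) k

end FloerNovikovComplex

/-! ### The Novikov field inside real-exponent Hahn series. -/

section NovikovField

open HahnSeries

/-! Since ω is injective on Γ₀ = ker deg, the Novikov ring of Γ₀ is a field Λ, realised here by Hahn
series with exponents in ω(Γ₀) and finitely many terms below every real (`novikovField`). The chains
of degree k form a finite-dimensional Λ-space with one coordinate for each fibre containing a
generator of grading k; ∂ is a matrix M over Λ, the level is a weighted non-Archimedean supremum
norm, and Δ is the constant coefficient of the dot product.

In such a normed space every subspace is the image of a projection of norm at most one
(`exists_norm_nonincreasing_projection`). Let E be such a projection onto the range of M, s a linear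
section of M over its range, and h = sE. Then ∂h = E does not raise the level, ∂h∂ = ∂, and the
transpose of h gives a Δ-adjoint h' (`exists_generalized_inverse`). No bound on h itself is needed.

Left kernel: let d annihilate every relative cycle, and put e = h'd. For each generator q, h∂q − q
is a cycle, so Δ(δe, q) = Δ(d, h∂q) = Δ(d, q), whence δe = d. If 𝒜(q) ≤ α, then ∂hq has level at
most α, so hq is a relative cycle and the coefficient Δ(d, hq) of e at q vanishes; hence e lies in
D^{(-∞,-α)}.

Right kernel: let c be annihilated by the cycles of D^{(-∞,-α)}. For 𝒜(p) > α, the chain p − h'δp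
represents the functional sending b to the coefficient of b − ∂hb at p. It is a cycle because ∂h∂ =
∂, and it lies in D^{(-∞,-α)} because ∂h does not raise the level. So c − ∂hc has no coefficient
above α. -/

/-- The Novikov subring: Hahn series with exponents in `G` and only finitely many terms below each
real number. -/
def novikovSubring (G : AddSubgroup ℝ) (K : Type*) [Field K] : Subring (HahnSeries ℝ K) where
  carrier := {x | (∀ r, x.coeff r ≠ 0 → r ∈ G) ∧ ∀ C : ℝ, {r | x.coeff r ≠ 0 ∧ r < C}.Finite}
  zero_mem' := by simp
  one_mem' := by
    have key : ∀ r : ℝ, (1 : HahnSeries ℝ K).coeff r ≠ 0 → r = 0 := by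
      intro r hr
      by_contra h
      exact hr (by simp [coeff_one, h])
    exact ⟨fun r hr => key r hr ▸ G.zero_mem,
      fun C => (Set.finite_singleton (0 : ℝ)).subset fun r hr => key r hr.1⟩
  add_mem' := by
    rintro x y ⟨hx, hx'⟩ ⟨hy, hy'⟩
    have key : ∀ r, (x + y).coeff r ≠ 0 → x.coeff r ≠ 0 ∨ y.coeff r ≠ 0 := by
      intro r hr
      by_contra! h
      exact hr (by simp [h.1, h.2])
    refine ⟨fun r hr => (key r hr).elim (hx r) (hy r),
      fun C => ((hx' C).union (hy' C)).subset ?_⟩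
    rintro r ⟨hr, hC⟩
    exact (key r hr).imp (fun h => ⟨h, hC⟩) (fun h => ⟨h, hC⟩)
  neg_mem' := by
    rintro x ⟨hx, hx'⟩
    simpa using ⟨hx, hx'⟩
  mul_mem' := by
    rintro x y ⟨hx, hx'⟩ ⟨hy, hy'⟩
    have key : ∀ r, (x * y).coeff r ≠ 0 → ∃ s t, x.coeff s ≠ 0 ∧ y.coeff t ≠ 0 ∧ s + t = r := by
      intro r hr
      obtain ⟨s, hs, t, ht, h⟩ := support_mul_subset hr
      exact ⟨s, t, hs, ht, h⟩
    refine ⟨fun r hr => ?_, fun C => ?_⟩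
    · obtain ⟨s, t, hs, ht, rfl⟩ := key r hr
      exact G.add_mem (hx s hs) (hy t ht)
    · refine (((hx' (C - y.order)).prod (hy' (C - x.order))).image
        (fun p : ℝ × ℝ => p.1 + p.2)).subset ?_
      rintro r ⟨hr, hC⟩
      obtain ⟨s, t, hs, ht, rfl⟩ := key r hr
      have h1 := order_le_of_coeff_ne_zero hs
      have h2 := order_le_of_coeff_ne_zero ht
      exact ⟨(s, t), ⟨⟨hs, by simp only; linarith⟩, ⟨ht, by simp only; linarith⟩⟩, rfl⟩

variable {G : AddSubgroup ℝ} {K : Type*} [Field K]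

theorem single_mem_novikovSubring {r : ℝ} (hr : r ∈ G) (a : K) :
    single r a ∈ novikovSubring G K := by
  have key : ∀ s, (single r a).coeff s ≠ 0 → s = r := by
    intro s hs
    by_contra h
    exact hs (coeff_single_of_ne h)
  exact ⟨fun s hs => key s hs ▸ hr,
    fun C => (Set.finite_singleton r).subset fun s hs => key s hs.1⟩

/-- A solution of `z = 1 + u z` with `u` in the Novikov ring of positive order lies in the Novikov
ring. -/
theorem mem_novikovSubring_of_eq_one_add_mul {u z : HahnSeries ℝ K} {ε : ℝ} (hε : 0 < ε)
    (hu : u ∈ novikovSubring G K) (hu' : ∀ r, u.coeff r ≠ 0 → ε ≤ r)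
    (hz : ∀ r, z.coeff r ≠ 0 → 0 ≤ r) (h : z = 1 + u * z) : z ∈ novikovSubring G K := by
  have key : ∀ r, z.coeff r ≠ 0 →
      r = 0 ∨ ∃ s t, u.coeff s ≠ 0 ∧ z.coeff t ≠ 0 ∧ s + t = r := by
    intro r hr
    by_cases h0 : r = 0
    · exact Or.inl h0
    · rw [h, coeff_add, coeff_one, if_neg h0, zero_add] at hr
      obtain ⟨s, hs, t, ht, hst⟩ := support_mul_subset hr
      exact Or.inr ⟨s, t, hs, ht, hst⟩
  -- Every exponent of u is at least ε, so terms of z below (n+1)ε other than the constant one are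
  -- products of terms of u below (n+1)ε and terms of z below nε. Induction on n thus controls z
  -- below every bound.
  have main : ∀ n : ℕ, (∀ r, z.coeff r ≠ 0 → r < n * ε → r ∈ G) ∧
      {r | z.coeff r ≠ 0 ∧ r < n * ε}.Finite := by
    intro n
    induction n with
    | zero =>
      have : ∀ r, z.coeff r ≠ 0 → ¬ r < (0 : ℕ) * ε := by
        intro r hr
        simpa using hz r hr
      refine ⟨fun r hr hr' => absurd hr' (this r hr), Set.finite_empty.subset ?_⟩
      rintro r ⟨hr, hr'⟩
      exact this r hr hr'
    | succ n ih =>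
      have key' : ∀ r, z.coeff r ≠ 0 → r < (n + 1 : ℕ) * ε → r = 0 ∨
          ∃ s t, (u.coeff s ≠ 0 ∧ s < (n + 1 : ℕ) * ε) ∧ (z.coeff t ≠ 0 ∧ t < n * ε) ∧
            s + t = r := by
        intro r hr hlt
        refine (key r hr).imp_right ?_
        rintro ⟨s, t, hs, ht, rfl⟩
        have h1 := hu' s hs
        have h2 := hz t ht
        push_cast at hlt ⊢
        exact ⟨s, t, ⟨hs, by linarith⟩, ⟨ht, by linarith⟩, rfl⟩
      refine ⟨fun r hr hlt => ?_, ?_⟩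
      · obtain rfl | ⟨s, t, hs, ht, rfl⟩ := key' r hr hlt
        · exact G.zero_mem
        · exact G.add_mem (hu.1 s hs.1) (ih.1 t ht.1 ht.2)
      · refine ((Set.finite_singleton (0 : ℝ)).union (((hu.2 ((n + 1 : ℕ) * ε)).prod ih.2).image
          (fun p : ℝ × ℝ => p.1 + p.2))).subset ?_
        rintro r ⟨hr, hlt⟩
        refine (key' r hr hlt).imp id ?_
        rintro ⟨s, t, hs, ht, rfl⟩
        exact ⟨(s, t), ⟨hs, ht⟩, rfl⟩
  have harch : ∀ C : ℝ, ∃ n : ℕ, C < n * ε := by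
    intro C
    obtain ⟨n, hn⟩ := exists_nat_gt (C / ε)
    exact ⟨n, (div_lt_iff₀ hε).mp hn⟩
  refine ⟨fun r hr => ?_, fun C => ?_⟩
  · obtain ⟨n, hn⟩ := harch r
    exact (main n).1 r hr hn
  · obtain ⟨n, hn⟩ := harch C
    exact (main n).2.subset fun r hr => ⟨hr.1, hr.2.trans hn⟩

/-- Dividing x by its leading term gives 1 − u with u of positive order, so the inverse z of 1 − u
solves z = 1 + uz. Inversion in the full Hahn series field supplies z, and only its exponents need
control. -/
theorem inv_mem_novikovSubring {x : HahnSeries ℝ K} (hx : x ∈ novikovSubring G K) :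
    x⁻¹ ∈ novikovSubring G K := by
  by_cases hx0 : x = 0
  · rw [hx0, inv_zero]
    exact zero_mem _
  set o := x.order with ho
  set a := x.leadingCoeff with ha
  have ha0 : a ≠ 0 := leadingCoeff_ne_zero.mpr hx0
  have hcoeff : x.coeff o = a := (leadingCoeff_eq).symm
  have hoG : o ∈ G := hx.1 o (by rwa [hcoeff])
  set m : HahnSeries ℝ K := single (-o) a⁻¹ with hm
  set m' : HahnSeries ℝ K := single o a with hm'
  have hmm : m * m' = 1 := by
    rw [hm, hm', single_mul_single, neg_add_cancel, inv_mul_cancel₀ ha0]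
    rfl
  have hmG : m ∈ novikovSubring G K := single_mem_novikovSubring (G.neg_mem hoG) _
  have hm0 : m ≠ 0 := left_ne_zero_of_mul_eq_one hmm
  set u := 1 - m * x with hu
  set z := m' * x⁻¹ with hz
  have huG : u ∈ novikovSubring G K := sub_mem (one_mem _) (mul_mem hmG hx)
  have hmxz : m * x * z = 1 := by
    rw [hz, show m * x * (m' * x⁻¹) = (m * m') * (x * x⁻¹) by ring, hmm,
      mul_inv_cancel₀ hx0, one_mul]
  have hzeq : z = 1 + u * z := by
    rw [hu, sub_mul, hmxz]
    ring
  have hcm : ∀ r, (m * x).coeff r = a⁻¹ * x.coeff (r + o) := by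
    intro r
    have := coeff_single_mul_add (r := a⁻¹) (x := x) (a := r + o) (b := -o)
    rwa [add_neg_cancel_right] at this
  have hupos : ∀ r, u.coeff r ≠ 0 → 0 < r := by
    intro r hr
    by_contra! hle
    apply hr
    rw [hu, coeff_sub, hcm, coeff_one]
    rcases hle.lt_or_eq with hlt | rfl
    · rw [if_neg hlt.ne, coeff_eq_zero_of_lt_order (by rw [← ho]; linarith), mul_zero, sub_zero]
    · rw [if_pos rfl, zero_add, hcoeff, inv_mul_cancel₀ ha0, sub_self]
  -- Orders add under multiplication, and both m * x and its product with z have order 0.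
  have hzpos : ∀ r, z.coeff r ≠ 0 → 0 ≤ r := by
    intro r hr
    have h1 := order_le_of_coeff_ne_zero hr
    have h2 : (m * x * z).order = 0 := by rw [hmxz, order_one]
    have hz0 : z ≠ 0 := by
      rintro h
      simp [h] at hr
    rw [order_mul (mul_ne_zero hm0 hx0) hz0, order_mul hm0 hx0,
      order_single (inv_ne_zero ha0), ← ho] at h2
    linarith
  obtain ⟨ε, hε, hε'⟩ : ∃ ε : ℝ, 0 < ε ∧ ∀ r, u.coeff r ≠ 0 → ε ≤ r := by
    by_cases hu0 : u = 0
    · exact ⟨1, one_pos, fun r hr => absurd (by rw [hu0]; rfl) hr⟩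
    · exact ⟨u.order, hupos _ (coeff_order_eq_zero.not.mpr hu0),
        fun r hr => order_le_of_coeff_ne_zero hr⟩
  have hzG := mem_novikovSubring_of_eq_one_add_mul hε huG hε' hzpos hzeq
  have : x⁻¹ = m * z := by rw [hz, ← mul_assoc, hmm, one_mul]
  rw [this]
  exact mul_mem hmG hzG

/-- The Novikov field with exponents in the subgroup `G` of `ℝ`. -/
def novikovField (G : AddSubgroup ℝ) (K : Type*) [Field K] : Subfield (HahnSeries ℝ K) where
  __ := novikovSubring G K
  inv_mem' _ hx := inv_mem_novikovSubring hx

/-- In a strictly decreasing sequence all terms after the first would be infinitely many elements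
below it. This lets coefficient families of chains be read as Hahn series. -/
theorem isPWO_of_finite_lt {s : Set ℝ} (h : ∀ C : ℝ, (s ∩ Set.Iio C).Finite) : s.IsPWO := by
  rw [Set.isPWO_iff_isWF]
  refine Set.isWF_iff_no_descending_seq.mpr fun f hf hfs => ?_
  refine Set.infinite_of_injective_forall_mem (f := fun n => f (n + 1)) ?_ ?_ (h (f 0))
  · intro a b hab
    simpa using hf.injective hab
  · intro n
    exact ⟨hfs _, hf (Nat.succ_pos n)⟩

theorem finsum_comp_of_support_subset_range {ι κ : Type*} {j : ι → κ} (hj : Function.Injective j)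
    {f : κ → K} (hf : Function.support f ⊆ Set.range j) : ∑ᶠ i, f (j i) = ∑ᶠ x, f x := by
  rw [← finsum_mem_range hj, finsum_mem_def, Set.indicator_eq_self.mpr hf]

/-- Parametrising the antidiagonal by its second entry gives the product the same `finsum` shape as
the pairing and the boundary formula. -/
theorem HahnSeries.coeff_mul_eq_finsum (x y : HahnSeries ℝ K) (r : ℝ) :
    (x * y).coeff r = ∑ᶠ s, x.coeff (r - s) * y.coeff s := by
  have hj : Function.Injective fun s : ℝ => (r - s, s) := fun a b h => congrArg Prod.snd h
  let F : ℝ × ℝ → K := fun p => if p.1 + p.2 = r then x.coeff p.1 * y.coeff p.2 else 0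
  have h1 : ∑ᶠ s, x.coeff (r - s) * y.coeff s = ∑ᶠ s, F (r - s, s) :=
    finsum_congr fun s => by simp [F]
  rw [h1, finsum_comp_of_support_subset_range hj (f := F), coeff_mul,
    finsum_eq_sum_of_support_subset]
  · refine Finset.sum_congr rfl fun p hp => ?_
    rw [Finset.mem_antidiagonal] at hp
    simp [F, hp.2.2]
  · intro p hp
    by_cases h : p.1 + p.2 = r
    · have hp' : x.coeff p.1 * y.coeff p.2 ≠ 0 := by simpa [F, h] using hp
      simp only [Finset.mem_coe, Finset.mem_antidiagonal]
      exact ⟨left_ne_zero_of_mul hp', right_ne_zero_of_mul hp', h⟩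
    · exact absurd (if_neg h) hp
  · intro p hp
    by_cases h : p.1 + p.2 = r
    · exact ⟨p.2, Prod.ext (by simp [← h]) rfl⟩
    · exact absurd (if_neg h) hp

end NovikovField

/-! ### Projections of norm at most one in non-Archimedean coordinate spaces. -/

section UltrametricProjection

/-- Every subspace of a coordinate space over a valued field, equipped with a weighted supremum
norm, is the image of a linear projection which does not increase the norm. -/
theorem exists_norm_nonincreasing_projection {F Γ₀ T : Type*} [Field F]
    [LinearOrderedCommGroupWithZero Γ₀] (v : Valuation F Γ₀) [Finite T] (w : T → Γ₀)
    (hw : ∀ t, w t ≠ 0) (B : Submodule F (T → F)) :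
    ∃ E : (T → F) →ₗ[F] (T → F), (∀ x, E x ∈ B) ∧ (∀ x ∈ B, E x = x) ∧
      ∀ x C, (∀ t, w t * v (x t) ≤ C) → ∀ t, w t * v (E x t) ≤ C := by
  induction hn : Module.finrank F B using Nat.strong_induction_on generalizing B with
  | _ n ih =>
  by_cases hB : B = ⊥
  · refine ⟨0, fun x => by simp, fun x hx => ?_, fun x C hx t => ?_⟩
    · rw [hB, Submodule.mem_bot] at hx
      rw [hx, map_zero]
    · simp
  obtain ⟨b, hbB, hb0⟩ := B.exists_mem_ne_zero_of_ne_bot hB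
  obtain ⟨t₀, ht₀⟩ := Function.ne_iff.mp hb0
  have : Nonempty T := ⟨t₀⟩
  -- At a coordinate p where the weighted norm of b is attained, f(x) = x_p / b_p gives ‖f(x) b‖ =
  -- w_p |x_p| ≤ ‖x‖. So R = f(·) b is a norm-nonincreasing projection onto the line of b.
  obtain ⟨p, hp⟩ := Finite.exists_max fun t => w t * v (b t)
  have hvt₀ : w t₀ * v (b t₀) ≠ 0 := mul_ne_zero (hw _) (v.ne_zero_iff.mpr ht₀)
  have hvp : w p * v (b p) ≠ 0 := fun h => hvt₀ (le_zero_iff.mp (h ▸ hp t₀))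
  have hvbp : v (b p) ≠ 0 := right_ne_zero_of_mul hvp
  have hbp : b p ≠ 0 := v.ne_zero_iff.mp hvbp
  let f : (T → F) →ₗ[F] F := (b p)⁻¹ • LinearMap.proj p
  have hf : ∀ x, f x = (b p)⁻¹ * x p := fun x => rfl
  have hfb : f b = 1 := by rw [hf, inv_mul_cancel₀ hbp]
  have hlt : Module.finrank F ↥(B ⊓ LinearMap.ker f) < n := by
    rw [← hn]
    refine Submodule.finrank_lt_finrank_of_lt (lt_of_le_of_ne inf_le_left fun h => ?_)
    have := LinearMap.mem_ker.mp (h.symm.le hbB).2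
    rw [hfb] at this
    exact one_ne_zero this
  obtain ⟨E', hE'B, hE'id, hE'le⟩ := ih _ hlt (B ⊓ LinearMap.ker f) rfl
  let R : (T → F) →ₗ[F] (T → F) := f.smulRight b
  have hR : ∀ x, R x = f x • b := fun x => rfl
  have hRle : ∀ x C, (∀ t, w t * v (x t) ≤ C) → ∀ t, w t * v (R x t) ≤ C := by
    intro x C hx t
    have h1 : v (R x t) = v (x p) * (v (b p))⁻¹ * v (b t) := by
      rw [hR, Pi.smul_apply, smul_eq_mul, hf, map_mul, map_mul, map_inv₀, mul_comm (v (b p))⁻¹]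
    rw [h1]
    calc w t * (v (x p) * (v (b p))⁻¹ * v (b t))
        = (w t * v (b t)) * (v (x p) * (v (b p))⁻¹) := by ac_rfl
      _ ≤ (w p * v (b p)) * (v (x p) * (v (b p))⁻¹) := mul_le_mul_left (hp t) _
      _ = w p * v (x p) * (v (b p) * (v (b p))⁻¹) := by ac_rfl
      _ = w p * v (x p) := by rw [mul_inv_cancel₀ hvbp, mul_one]
      _ ≤ C := hx p
  -- B is the sum of the line of b and B ∩ ker f. Here R handles the line and the inductive E'
  -- handles the remainder x − Rx; the ultrametric inequality keeps both differences and sums within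
  -- the bound C.
  refine ⟨R + E' ∘ₗ (LinearMap.id - R), fun x => ?_, fun x hx => ?_, fun x C hx t => ?_⟩
  · exact B.add_mem (B.smul_mem _ hbB) (hE'B _).1
  · have : x - R x ∈ B ⊓ LinearMap.ker f := by
      refine ⟨B.sub_mem hx (B.smul_mem _ hbB), ?_⟩
      change f (x - R x) = 0
      rw [map_sub, hR, map_smul, hfb, smul_eq_mul, mul_one, sub_self]
    change R x + E' (x - R x) = x
    rw [hE'id _ this, add_sub_cancel]
  · have h2 : ∀ a c : F, w t * v a ≤ C → w t * v c ≤ C → w t * v (a + c) ≤ C := by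
      intro a c ha hc
      rcases le_max_iff.mp (v.map_add a c) with h | h
      · exact (mul_le_mul_right h _).trans ha
      · exact (mul_le_mul_right h _).trans hc
    have h3 : ∀ s, w s * v ((x - R x) s) ≤ C := by
      intro s
      rcases le_max_iff.mp (v.map_sub (x s) (R x s)) with h | h
      · exact (mul_le_mul_right h _).trans (hx s)
      · exact (mul_le_mul_right h _).trans (hRle x C hx s)
    exact h2 _ _ (hRle x C hx t) (hE'le _ C h3 t)

end UltrametricProjection

/-! ### Filtration levels as weighted norms over the Novikov field. -/

section NovikovProjection

variable {G : AddSubgroup ℝ} {K : Type*} [Field K]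

theorem HahnSeries.forall_sub_le_iff (x : HahnSeries ℝ K) (a C : ℝ) :
    (∀ r, x.coeff r ≠ 0 → a - r ≤ C) ↔
      ((-C : ℝ) : WithTop ℝ) ≤ ((-a : ℝ) : WithTop ℝ) + HahnSeries.addVal ℝ K x := by
  by_cases hx : x = 0
  · simp [hx]
  · rw [HahnSeries.addVal_apply_of_ne hx, ← WithTop.coe_add, WithTop.coe_le_coe]
    constructor
    · intro h
      have := h _ (HahnSeries.coeff_order_eq_zero.not.mpr hx)
      linarith
    · intro h r hr
      have := HahnSeries.order_le_of_coeff_ne_zero hr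
      linarith

/-- Every subspace of a coordinate space over the Novikov field is the image of a linear projection
which does not increase the filtration level. -/
theorem exists_level_nonincreasing_projection {T : Type*} [Finite T] (a : T → ℝ)
    (B : Submodule (novikovField G K) (T → novikovField G K)) :
    ∃ E : (T → novikovField G K) →ₗ[novikovField G K] (T → novikovField G K),
      (∀ x, E x ∈ B) ∧ (∀ x ∈ B, E x = x) ∧
      ∀ x (C : ℝ), (∀ t r, (x t).1.coeff r ≠ 0 → a t - r ≤ C) →
        ∀ t r, (E x t).1.coeff r ≠ 0 → a t - r ≤ C := by
  -- Reversing the order of the additive valuation makes v(x) behave like exp(−ord x) and e(r) like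
  -- exp(r), so the weight e(a t) turns the norm into the filtration level.
  let v : Valuation (novikovField G K) (Multiplicative (WithTop ℝ)ᵒᵈ) :=
    AddValuation.toValuation ((HahnSeries.addVal ℝ K).comap (novikovField G K).subtype)
  let e : ℝ → Multiplicative (WithTop ℝ)ᵒᵈ := fun r =>
    Multiplicative.ofAdd (OrderDual.toDual ((-r : ℝ) : WithTop ℝ))
  have hv : ∀ (x : novikovField G K) (b C : ℝ),
      (∀ r, x.1.coeff r ≠ 0 → b - r ≤ C) ↔ e b * v x ≤ e C :=
    fun x b C => x.1.forall_sub_le_iff b C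
  obtain ⟨E, h1, h2, h3⟩ := exists_norm_nonincreasing_projection v (fun t => e (a t))
    (fun t h => WithTop.coe_ne_top (a := -a t) h) B
  refine ⟨E, h1, h2, fun x C hx t => (hv _ _ _).mpr (h3 x (e C) (fun t => ?_) t)⟩
  exact (hv _ _ _).mp (hx t)

end NovikovProjection

/-! ### Coordinates of chains over the Novikov field. -/

namespace FloerNovikovData

variable {Γ P S : Type*} [CommGroup Γ] (X : FloerNovikovData Γ P S)

/-- The group of periods of the elements of degree zero. -/
def periodGroup : AddSubgroup ℝ where
  carrier := {r | ∃ g, X.deg g = 0 ∧ X.period g = r}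
  zero_mem' := ⟨1, X.deg_one, X.period_one⟩
  add_mem' := by
    rintro _ _ ⟨g, hg, rfl⟩ ⟨h, hh, rfl⟩
    exact ⟨g * h, by rw [X.deg_mul, hg, hh, add_zero], X.period_mul g h⟩
  neg_mem' := by
    rintro _ ⟨g, hg, rfl⟩
    exact ⟨g⁻¹, by rw [X.deg_inv, hg, neg_zero], X.period_inv g⟩

/-- A choice of representatives of the orbits of `ker deg` on the generators of grading `k`, where
the period homomorphism identifies `ker deg` with `G`. -/
structure Frame (G : AddSubgroup ℝ) (k : ℤ) (T : Type*) where
  period_injOn : Set.InjOn X.period {g | X.deg g = 0}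
  mem_iff : ∀ r, r ∈ G ↔ ∃ g, X.deg g = 0 ∧ X.period g = r
  rep : T → P
  gr_rep : ∀ t, X.gr (rep t) = k
  proj_rep_injective : ∀ t t', X.proj (rep t) = X.proj (rep t') → t = t'
  exists_proj_rep : ∀ p, X.gr p = k → ∃ t, X.proj (rep t) = X.proj p

/-- Within one fibre, the generators of grading k form a single orbit of ker deg or none at all. The
index set is therefore the set of fibres meeting grading k, which is finite because S is. -/
theorem exists_frame (hinj : Set.InjOn X.period {g | X.deg g = 0}) (k : ℤ) :
    Nonempty (X.Frame X.periodGroup k {s : S // ∃ p, X.proj p = s ∧ X.gr p = k}) := by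
  choose rep hrep hgr using
    fun s : {s : S // ∃ p, X.proj p = s ∧ X.gr p = k} => s.2
  refine ⟨⟨hinj, fun r => Iff.rfl, rep, hgr, fun s t h => ?_, fun p hp => ?_⟩⟩
  · rw [hrep, hrep] at h
    exact Subtype.ext h
  · exact ⟨⟨X.proj p, p, rfl, hp⟩, hrep _⟩

theorem graded_ext {K : Type*} [Field K] {k : ℤ} {c c' : X.chains K} (hc : c ∈ X.graded K k)
    (hc' : c' ∈ X.graded K k) (h : ∀ p, X.gr p = k → c.1 p = c'.1 p) : c = c' := by
  refine Subtype.ext (funext fun p => ?_)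
  by_cases hp : X.gr p = k
  · exact h p hp
  · rw [not_not.mp (mt (hc p) hp), not_not.mp (mt (hc' p) hp)]

namespace Frame

variable {X} {G : AddSubgroup ℝ} {k : ℤ} {T : Type*} (F : X.Frame G k T)

/-- The same representatives, for the opposite complex. -/
def op : X.op.Frame G (-k) T where
  period_injOn := F.period_injOn
  mem_iff := F.mem_iff
  rep := F.rep
  gr_rep t := congrArg Neg.neg (F.gr_rep t)
  proj_rep_injective := F.proj_rep_injective
  exists_proj_rep p hp := F.exists_proj_rep p (neg_injective hp)

theorem act_rep_injective {t t' : T} {g g' : Γ} (h : X.act g (F.rep t) = X.act g' (F.rep t')) :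
    t = t' ∧ g = g' := by
  have ht : t = t' := by
    refine F.proj_rep_injective t t' ?_
    rw [(X.proj_eq_iff (F.rep t) _).mpr ⟨g, rfl⟩, h,
      ← (X.proj_eq_iff (F.rep t') _).mpr ⟨g', rfl⟩]
  subst ht
  exact ⟨rfl, X.act_left_injective _ h⟩

theorem gr_act_rep {g : Γ} (hg : X.deg g = 0) (t : T) : X.gr (X.act g (F.rep t)) = k := by
  rw [X.gr_act, F.gr_rep, hg, sub_zero]

theorem exists_act_rep {p : P} (hp : X.gr p = k) :
    ∃ t g, X.deg g = 0 ∧ X.act g (F.rep t) = p := by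
  obtain ⟨t, ht⟩ := F.exists_proj_rep p hp
  obtain ⟨g, rfl⟩ := (X.proj_eq_iff _ _).mp ht
  rw [X.gr_act, F.gr_rep] at hp
  exact ⟨t, g, by linarith, rfl⟩

theorem period_mem (F : X.Frame G k T) {g : Γ} (hg : X.deg g = 0) : X.period g ∈ G :=
  (F.mem_iff _).mpr ⟨g, hg, rfl⟩

variable {K : Type*} [Field K]

open Classical in
/-- The coefficient of `c` at the point of the orbit of `rep t` which has relative action `-r`. -/
noncomputable def coordCoeff (c : P → K) (t : T) (r : ℝ) : K :=
  if h : ∃ g, X.deg g = 0 ∧ X.period g = r then c (X.act h.choose (F.rep t)) else 0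

/-- Injectivity of the period on ker deg makes the chosen group element unique; this is where the
hypothesis of the theorem enters the coordinates. -/
theorem coordCoeff_period (c : P → K) (t : T) {g : Γ} (hg : X.deg g = 0) :
    F.coordCoeff c t (X.period g) = c (X.act g (F.rep t)) := by
  have h : ∃ g', X.deg g' = 0 ∧ X.period g' = X.period g := ⟨g, hg, rfl⟩
  rw [coordCoeff, dif_pos h, F.period_injOn h.choose_spec.1 hg h.choose_spec.2]

theorem exists_of_coordCoeff_ne_zero {c : P → K} {t : T} {r : ℝ} (h : F.coordCoeff c t r ≠ 0) :
    ∃ g, X.deg g = 0 ∧ X.period g = r ∧ c (X.act g (F.rep t)) ≠ 0 := by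
  by_cases hex : ∃ g, X.deg g = 0 ∧ X.period g = r
  · obtain ⟨g, hg, rfl⟩ := hex
    rw [F.coordCoeff_period c t hg] at h
    exact ⟨g, hg, rfl, h⟩
  · exact absurd (dif_neg hex) h

theorem coordCoeff_finite (c : X.chains K) (t : T) (C : ℝ) :
    {r | F.coordCoeff c.1 t r ≠ 0 ∧ r < C}.Finite := by
  refine ((c.2.2 (X.action (F.rep t) - C)).image
    fun p => X.action (F.rep t) - X.action p).subset ?_
  rintro r ⟨hr, hC⟩
  obtain ⟨g, -, rfl, hc⟩ := F.exists_of_coordCoeff_ne_zero hr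
  refine ⟨_, ⟨hc, ?_⟩, ?_⟩
  · rw [X.action_act]
    linarith
  · simp only [X.action_act]
    ring

/-- The coordinates of a chain of degree `k` over the Novikov field. -/
noncomputable def coords (c : X.chains K) (t : T) : novikovField G K :=
  ⟨⟨F.coordCoeff c.1 t, isPWO_of_finite_lt (F.coordCoeff_finite c t)⟩, by
    refine ⟨fun r hr => ?_, F.coordCoeff_finite c t⟩
    obtain ⟨g, hg, rfl, -⟩ := F.exists_of_coordCoeff_ne_zero hr
    exact F.period_mem hg⟩

theorem coords_coeff (c : X.chains K) (t : T) {g : Γ} (hg : X.deg g = 0) :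
    (F.coords c t).1.coeff (X.period g) = c.1 (X.act g (F.rep t)) :=
  F.coordCoeff_period c.1 t hg

/-- The opposite action is through inverses, so the point g · rep t carries exponent −ω(g). It is
written as 0 − ω(g) to match a convolution evaluated at exponent 0. -/
theorem op_coords_coeff (d : X.op.chains K) (t : T) {g : Γ} (hg : X.deg g = 0) :
    (F.op.coords d t).1.coeff (0 - X.period g) = d.1 (X.act g (F.rep t)) := by
  have hg' : X.op.deg g⁻¹ = 0 := (X.deg_inv g).trans (by rw [hg, neg_zero])
  have h := F.op.coords_coeff d t hg'
  have h1 : X.op.period g⁻¹ = 0 - X.period g := (X.period_inv g).trans (zero_sub _).symm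
  have h2 : X.op.act g⁻¹ (F.op.rep t) = X.act g (F.rep t) := congrArg (X.act · _) (inv_inv g)
  rwa [h1, h2] at h

theorem novikovField_ext (F : X.Frame G k T) {x y : novikovField G K}
    (h : ∀ g, X.deg g = 0 → x.1.coeff (X.period g) = y.1.coeff (X.period g)) : x = y := by
  refine Subtype.ext (HahnSeries.ext (funext fun r => ?_))
  by_cases hr : r ∈ G
  · obtain ⟨g, hg, rfl⟩ := (F.mem_iff r).mp hr
    exact h g hg
  · rw [not_not.mp (mt (x.2.1 r) hr), not_not.mp (mt (y.2.1 r) hr)]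

open Classical in
/-- The coefficients of the chain with given coordinates. -/
noncomputable def ofCoordsFun (x : T → novikovField G K) (p : P) : K :=
  if h : ∃ y : T × Γ, X.deg y.2 = 0 ∧ X.act y.2 (F.rep y.1) = p then
    (x h.choose.1).1.coeff (X.period h.choose.2) else 0

theorem ofCoordsFun_act (x : T → novikovField G K) (t : T) {g : Γ} (hg : X.deg g = 0) :
    F.ofCoordsFun x (X.act g (F.rep t)) = (x t).1.coeff (X.period g) := by
  have h : ∃ y : T × Γ, X.deg y.2 = 0 ∧ X.act y.2 (F.rep y.1) = X.act g (F.rep t) :=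
    ⟨(t, g), hg, rfl⟩
  obtain ⟨h1, h2⟩ := F.act_rep_injective h.choose_spec.2
  rw [ofCoordsFun, dif_pos h, h1, h2]

theorem exists_of_ofCoordsFun_ne_zero {x : T → novikovField G K} {p : P}
    (h : F.ofCoordsFun x p ≠ 0) :
    ∃ t g, X.deg g = 0 ∧ X.act g (F.rep t) = p ∧ (x t).1.coeff (X.period g) ≠ 0 := by
  by_cases hex : ∃ y : T × Γ, X.deg y.2 = 0 ∧ X.act y.2 (F.rep y.1) = p
  · obtain ⟨⟨t, g⟩, hg, rfl⟩ := hex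
    rw [F.ofCoordsFun_act x t hg] at h
    exact ⟨t, g, hg, rfl, h⟩
  · exact absurd (dif_neg hex) h

/-- The chain of degree `k` with given coordinates over the Novikov field. -/
noncomputable def ofCoords [Finite T] (x : T → novikovField G K) : X.chains K :=
  ⟨F.ofCoordsFun x, by
    refine ⟨(Set.finite_singleton k).subset ?_, fun C => ?_⟩
    · rintro _ ⟨p, hp, rfl⟩
      obtain ⟨t, g, hg, rfl, -⟩ := F.exists_of_ofCoordsFun_ne_zero hp
      exact F.gr_act_rep hg t
    · have key : ∀ t, {g | X.deg g = 0 ∧ (x t).1.coeff (X.period g) ≠ 0 ∧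
          X.period g < X.action (F.rep t) - C}.Finite := fun t =>
        Set.Finite.of_finite_image (((x t).2.2 (X.action (F.rep t) - C)).subset (by
          rintro _ ⟨g, hg, rfl⟩
          exact hg.2)) (F.period_injOn.mono fun g hg => hg.1)
      refine (Set.finite_iUnion fun t => (key t).image fun g => X.act g (F.rep t)).subset ?_
      rintro p ⟨hp, hC⟩
      obtain ⟨t, g, hg, rfl, h⟩ := F.exists_of_ofCoordsFun_ne_zero hp
      rw [X.action_act] at hC
      exact Set.mem_iUnion.mpr ⟨t, g, ⟨hg, h, by linarith⟩, rfl⟩⟩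

theorem ofCoords_act [Finite T] (x : T → novikovField G K) (t : T) {g : Γ} (hg : X.deg g = 0) :
    (F.ofCoords x).1 (X.act g (F.rep t)) = (x t).1.coeff (X.period g) :=
  F.ofCoordsFun_act x t hg

theorem ofCoords_mem_graded [Finite T] (x : T → novikovField G K) :
    F.ofCoords x ∈ X.graded K k := by
  intro p hp
  obtain ⟨t, g, hg, rfl, -⟩ := F.exists_of_ofCoordsFun_ne_zero hp
  exact F.gr_act_rep hg t

theorem coords_ofCoords [Finite T] (x : T → novikovField G K) : F.coords (F.ofCoords x) = x :=
  funext fun t => F.novikovField_ext fun g hg => by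
    rw [F.coords_coeff _ t hg, F.ofCoords_act x t hg]

theorem coords_injOn {c c' : X.chains K} (hc : c ∈ X.graded K k) (hc' : c' ∈ X.graded K k)
    (h : F.coords c = F.coords c') : c = c' := by
  refine X.graded_ext hc hc' fun p hp => ?_
  obtain ⟨t, g, hg, rfl⟩ := F.exists_act_rep hp
  rw [← F.coords_coeff c t hg, h, F.coords_coeff c' t hg]

/-- Exponent r in coordinate t stands for a point of action 𝒜(rep t) − r. -/
theorem level_le_iff_coords {c : X.chains K} (hc : c ∈ X.graded K k) (C : ℝ) :
    X.level c ≤ C ↔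
      ∀ t r, (F.coords c t).1.coeff r ≠ 0 → X.action (F.rep t) - r ≤ C := by
  rw [X.level_le_iff]
  constructor
  · intro h t r hr
    obtain ⟨g, -, rfl, hg⟩ := F.exists_of_coordCoeff_ne_zero hr
    rw [← X.action_act]
    exact h _ hg
  · intro h p hp
    obtain ⟨t, g, hg, rfl⟩ := F.exists_act_rep (hc p hp)
    rw [X.action_act]
    exact h t _ (by rwa [F.coords_coeff c t hg])

/-- The points g · rep t with deg g = 0 enumerate the generators of grading k without repetition. -/
theorem finsum_eq_sum [Fintype T] {f : P → K} (hf : (Function.support f).Finite)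
    (hk : ∀ p, f p ≠ 0 → X.gr p = k) :
    ∑ᶠ p, f p = ∑ t, ∑ᶠ g : {g // X.deg g = 0}, f (X.act g.1 (F.rep t)) := by
  have hj : Function.Injective
      fun y : T × {g // X.deg g = 0} => X.act y.2.1 (F.rep y.1) := by
    rintro ⟨t, g⟩ ⟨t', g'⟩ h
    obtain ⟨h1, h2⟩ := F.act_rep_injective h
    exact Prod.ext h1 (Subtype.ext h2)
  rw [← finsum_comp_of_support_subset_range hj, finsum_curry, finsum_eq_sum_of_fintype]
  · exact hf.preimage hj.injOn
  · intro p hp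
    obtain ⟨t, g, hg, rfl⟩ := F.exists_act_rep (hk p hp)
    exact ⟨(t, ⟨g, hg⟩), rfl⟩

theorem novikovField_coeff_mul (F : X.Frame G k T) (x y : novikovField G K)
    (r : ℝ) :
    (x * y).1.coeff r =
      ∑ᶠ g : {g // X.deg g = 0}, x.1.coeff (r - X.period g.1) * y.1.coeff (X.period g.1) := by
  have hj : Function.Injective fun g : {g // X.deg g = 0} => X.period g.1 :=
    fun g h hgh => Subtype.ext (F.period_injOn g.2 h.2 hgh)
  refine (HahnSeries.coeff_mul_eq_finsum x.1 y.1 r).trans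
    (finsum_comp_of_support_subset_range hj
      (f := fun s => x.1.coeff (r - s) * y.1.coeff s) ?_).symm
  intro s hs
  obtain ⟨g, hg, rfl⟩ := (F.mem_iff s).mp (y.2.1 s (right_ne_zero_of_mul hs))
  exact ⟨⟨g, hg⟩, rfl⟩

theorem coeff_dotProduct (F : X.Frame G k T) [Fintype T] (x y : T → novikovField G K) (r : ℝ) :
    (x ⬝ᵥ y).1.coeff r = ∑ t, ∑ᶠ g : {g // X.deg g = 0},
      (x t).1.coeff (r - X.period g.1) * (y t).1.coeff (X.period g.1) := by
  have h : (x ⬝ᵥ y).1 = ∑ t, (x t * y t).1 :=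
    map_sum (novikovField G K).subtype (fun t => x t * y t) Finset.univ
  rw [h, HahnSeries.coeff_sum]
  exact Finset.sum_congr rfl fun t _ => F.novikovField_coeff_mul _ _ _

/-- A point has opposite exponents ∓ω(g) in the two complexes, so the constant coefficient of the
product collects exactly the matching points. Consequently transposed matrices over the Novikov
field are adjoint for Δ. -/
theorem pairing_eq [Fintype T] (d : X.op.chains K) {c : X.chains K} (hc : c ∈ X.graded K k) :
    X.pairing K d c = (F.op.coords d ⬝ᵥ F.coords c).1.coeff 0 := by
  rw [X.pairing_apply, F.coeff_dotProduct, F.finsum_eq_sum (X.pairing_finite d c)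
    fun p hp => hc p (right_ne_zero_of_mul hp)]
  refine Finset.sum_congr rfl fun t _ => finsum_congr fun g => ?_
  rw [F.op_coords_coeff d t g.2, F.coords_coeff c t g.2]

end Frame

end FloerNovikovData

/-! ### Generators as test elements for the pairing. -/

namespace FloerNovikovData

variable {Γ P S : Type*} [CommGroup Γ] (X : FloerNovikovData Γ P S) {K : Type*} [Field K]

theorem gen_apply_self (p : P) : (X.gen K p).1 p = 1 := by
  classical
  exact Pi.single_eq_same p 1

theorem gen_apply_of_ne {p q : P} (h : q ≠ p) : (X.gen K p).1 q = 0 := by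
  classical
  exact Pi.single_eq_of_ne h 1

theorem eq_of_gen_ne_zero {p q : P} (h : (X.gen K p).1 q ≠ 0) : q = p := by
  by_contra hq
  exact h (X.gen_apply_of_ne hq)

theorem gen_mem_graded (p : P) : X.gen K p ∈ X.graded K (X.gr p) := fun q hq => by
  rw [X.eq_of_gen_ne_zero hq]

theorem level_gen_le (p : P) : X.level (X.gen K p) ≤ (X.action p : ℝ) :=
  (X.level_le_iff _ _).mpr fun q hq => by rw [X.eq_of_gen_ne_zero hq]

theorem pairing_gen_right (d : X.op.chains K) (q : P) : X.pairing K d (X.gen K q) = d.1 q := by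
  rw [X.pairing_apply, finsum_eq_single _ q, X.gen_apply_self, mul_one]
  intro p hp
  rw [X.gen_apply_of_ne hp, mul_zero]

theorem pairing_gen_left (p : P) (c : X.chains K) : X.pairing K (X.op.gen K p) c = c.1 p := by
  rw [X.pairing_apply, finsum_eq_single _ p, X.op.gen_apply_self, one_mul]
  intro q hq
  rw [X.op.gen_apply_of_ne hq, zero_mul]

end FloerNovikovData

/-! ### The generalized inverse of the boundary operator and its consequences. -/

namespace FloerNovikovComplex

variable {K Γ P S : Type*} [Field K] [CommGroup Γ] (X : FloerNovikovComplex K Γ P S)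

/-- The matrix of the boundary operator over the Novikov field. -/
noncomputable def bdMatrix {G : AddSubgroup ℝ} {j k : ℤ} {T T' : Type*}
    (F : X.toFloerNovikovData.Frame G k T) (F' : X.toFloerNovikovData.Frame G j T') :
    Matrix T' T (novikovField G K) :=
  Matrix.of fun t' t => F'.coords (X.bd (X.gen K (F.rep t))) t'

/-- Since n(gp, gq) = n(p, q), the coefficients depend only on the difference of the exponents, and
the sum defining ∂c becomes a convolution, that is, multiplication in the Novikov field. -/
theorem coords_bd {G : AddSubgroup ℝ} {j k : ℤ} {T T' : Type*} [Fintype T]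
    (F : X.toFloerNovikovData.Frame G k T) (F' : X.toFloerNovikovData.Frame G j T')
    {c : X.chains K} (hc : c ∈ X.graded K k) :
    F'.coords (X.bd c) = (X.bdMatrix F F').mulVec (F.coords c) := by
  refine funext fun t' => F'.novikovField_ext fun g hg => ?_
  rw [F'.coords_coeff _ t' hg, X.bd_apply, F.finsum_eq_sum (X.bd_apply_finite c _)
    fun p hp => hc p (left_ne_zero_of_mul hp), Matrix.mulVec, F.coeff_dotProduct]
  refine Finset.sum_congr rfl fun t _ => finsum_congr fun h => ?_
  have hgh : X.deg (h.1⁻¹ * g) = 0 := by rw [X.deg_mul, X.deg_inv, h.2, hg]; rfl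
  have hper : X.period g - X.period h.1 = X.period (h.1⁻¹ * g) := by
    rw [X.period_mul, X.period_inv]
    ring
  have hcoeff : X.coeff (X.act h.1 (F.rep t)) (X.act g (F'.rep t')) =
      X.coeff (F.rep t) (X.act (h.1⁻¹ * g) (F'.rep t')) := by
    rw [← X.coeff_act h.1 (F.rep t), ← X.mul_act h.1, mul_inv_cancel_left]
  rw [F.coords_coeff c t h.2, hper, hcoeff, mul_comm]
  exact congrArg (· * _) (F'.coords_coeff _ t' hgh).symm

/-- The boundary operator has a generalized inverse `h`, with an adjoint on the opposite complex,
such that `∂h` is a projection which does not increase the filtration level. -/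
theorem exists_generalized_inverse (hinj : Set.InjOn X.period {g | X.deg g = 0}) {j k : ℤ}
    (hjk : j = k - 1) :
    ∃ (h : X.chains K → X.chains K)
      (h' : X.toFloerNovikovData.op.chains K → X.toFloerNovikovData.op.chains K),
      (∀ c, h c ∈ X.graded K k) ∧ (∀ d, h' d ∈ X.toFloerNovikovData.op.graded K (-j)) ∧
      (∀ d, ∀ c ∈ X.graded K j, X.pairing K (h' d) c = X.pairing K d (h c)) ∧
      (∀ c ∈ X.graded K k, X.bd (h (X.bd c)) = X.bd c) ∧
      ∀ c ∈ X.graded K j, ∀ C : ℝ, X.level c ≤ C → X.level (X.bd (h c)) ≤ C := by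
  classical
  obtain ⟨F⟩ := X.exists_frame hinj k
  obtain ⟨F'⟩ := X.exists_frame hinj j
  have := X.finite_base
  have := Fintype.ofFinite S
  let M := X.bdMatrix F F'
  have hbd : ∀ c ∈ X.graded K k, X.bd c ∈ X.graded K j := fun c hc => hjk ▸ X.bd_graded k c hc
  obtain ⟨E, hEM, hEid, hEle⟩ := exists_level_nonincreasing_projection
    (fun t => X.action (F'.rep t)) (LinearMap.range M.mulVecLin)
  obtain ⟨s, hs⟩ := M.mulVecLin.rangeRestrict.exists_rightInverse_of_surjective
    M.mulVecLin.range_rangeRestrict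
  -- H is the section s after the projection E, so M H = E. Being a matrix, it can be transposed to
  -- give the adjoint.
  let H := LinearMap.toMatrix' (s ∘ₗ E.codRestrict _ hEM)
  have hMH : ∀ x, M.mulVec (H.mulVec x) = E x := by
    intro x
    have h1 : H.mulVec x = s (E.codRestrict _ hEM x) := LinearMap.toMatrix'_mulVec _ _
    rw [h1]
    exact congrArg Subtype.val (LinearMap.congr_fun hs (E.codRestrict _ hEM x))
  have hcoords : ∀ c, F'.coords (X.bd (F.ofCoords (H.mulVec (F'.coords c)))) =
      E (F'.coords c) := by
    intro c
    rw [X.coords_bd F F' (F.ofCoords_mem_graded _), F.coords_ofCoords, hMH]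
  refine ⟨fun c => F.ofCoords (H.mulVec (F'.coords c)),
    fun d => F'.op.ofCoords (Matrix.vecMul (F.op.coords d) H),
    fun c => F.ofCoords_mem_graded _, fun d => F'.op.ofCoords_mem_graded _,
    fun d c hc => ?_, fun c hc => ?_, fun c hc C hC => ?_⟩
  · rw [F'.pairing_eq _ hc, F.pairing_eq _ (F.ofCoords_mem_graded _), F'.op.coords_ofCoords,
      F.coords_ofCoords, Matrix.dotProduct_mulVec]
  · refine F'.coords_injOn (hbd _ (F.ofCoords_mem_graded _)) (hbd c hc) ?_
    rw [hcoords]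
    refine hEid _ ⟨F.coords c, ?_⟩
    rw [X.coords_bd F F' hc]
    rfl
  · rw [F'.level_le_iff_coords (hbd _ (F.ofCoords_mem_graded _)), hcoords]
    exact hEle _ C ((F'.level_le_iff_coords hc C).mp hC)

/-- A chain of the opposite complex which annihilates all relative cycles is a relative
boundary. -/
theorem exists_delta_eq (hinj : Set.InjOn X.period {g | X.deg g = 0}) (α : ℝ) (k : ℤ)
    {d : X.toFloerNovikovData.op.chains K} (hd : d ∈ X.toFloerNovikovData.op.graded K (-k))
    (hann : ∀ c ∈ X.graded K k, X.bd c ∈ X.filtLE K α → X.pairing K d c = 0) :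
    ∃ e ∈ X.toFloerNovikovData.op.graded K (-k + 1),
      e ∈ X.toFloerNovikovData.op.filtLT K (-α) ∧ X.delta e = d := by
  obtain ⟨h, h', hh, hh', hadj, hinv, hle⟩ := X.exists_generalized_inverse hinj (k := k) rfl
  have he : h' d ∈ X.toFloerNovikovData.op.graded K (-k + 1) := by
    have := hh' d
    rwa [neg_sub, sub_eq_neg_add] at this
  refine ⟨h' d, he, ?_, ?_⟩
  -- If 𝒜(q) ≤ α, then hq is a relative cycle because ∂h does not raise levels, so d annihilates it
  -- and the coefficient of h'd at q vanishes.
  · refine (X.toFloerNovikovData.op.level_lt_iff _ _).mpr fun q hq => neg_lt_neg ?_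
    by_contra! hqα
    have hgr : X.gr q = k - 1 := neg_injective (hh' d q hq)
    have hgen : X.gen K q ∈ X.graded K (k - 1) := hgr ▸ X.gen_mem_graded q
    apply hq
    rw [← X.pairing_gen_right (h' d) q, hadj d _ hgen]
    refine hann _ (hh _) (hle _ hgen α ((X.level_gen_le q).trans ?_))
    exact EReal.coe_le_coe_iff.mpr hqα
  · have hδ : X.delta (h' d) ∈ X.toFloerNovikovData.op.graded K (-k) := by
      have := X.op.bd_graded (-k + 1) (h' d) he
      rwa [add_sub_cancel_right] at this
    refine X.toFloerNovikovData.op.graded_ext hδ hd fun q hq => ?_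
    have hgen : X.gen K q ∈ X.graded K k := by
      have : X.gr q = k := neg_injective hq
      exact this ▸ X.gen_mem_graded q
    have hbd := X.bd_graded k _ hgen
    rw [← X.pairing_gen_right d q, ← X.pairing_gen_right (X.delta (h' d)) q, X.pairing_delta,
      hadj d _ hbd, ← sub_eq_zero, ← map_sub]
    refine hann _ ((X.graded K k).sub_mem (hh _) hgen) ?_
    -- The difference h∂q − q is an honest cycle, since ∂h∂ = ∂.
    rw [map_sub, hinv _ hgen, sub_self]
    exact zero_mem _

/-- A chain which is annihilated by all cycles of `D_*^{(-∞,-α)}` is a boundary modulo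
`C_*^{(-∞,α]}`. -/
theorem exists_sub_bd_mem_filtLE (hinj : Set.InjOn X.period {g | X.deg g = 0}) (α : ℝ) (k : ℤ)
    {c : X.chains K} (hc : c ∈ X.graded K k)
    (hann : ∀ d ∈ X.toFloerNovikovData.op.graded K (-k),
      d ∈ X.toFloerNovikovData.op.filtLT K (-α) → X.delta d = 0 → X.pairing K d c = 0) :
    ∃ e ∈ X.graded K (k + 1), c - X.bd e ∈ X.filtLE K α := by
  obtain ⟨h, h', hh, hh', hadj, hinv, hle⟩ :=
    X.exists_generalized_inverse hinj (j := k) (k := k + 1) (by ring)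
  refine ⟨h c, hh c, ?_⟩
  by_contra hnot
  obtain ⟨p, hp, hpα⟩ : ∃ p, (c - X.bd (h c)).1 p ≠ 0 ∧ α < X.action p := by
    by_contra! hall
    exact hnot ((X.level_le_iff _ _).mpr hall)
  have hbdh : ∀ b, X.bd (h b) ∈ X.graded K k := fun b => by
    have := X.bd_graded (k + 1) _ (hh b)
    rwa [add_sub_cancel_right] at this
  have hgr : X.gr p = k := (X.graded K k).sub_mem hc (hbdh c) p hp
  -- This d represents the functional taking b to the coefficient of b − ∂hb at p.
  let d := X.toFloerNovikovData.op.gen K p - h' (X.delta (X.toFloerNovikovData.op.gen K p))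
  have hpair : ∀ b ∈ X.graded K k, X.pairing K d b = (b - X.bd (h b)).1 p := by
    intro b hb
    rw [map_sub, LinearMap.sub_apply, hadj _ b hb, X.pairing_delta, X.pairing_gen_left,
      X.pairing_gen_left]
    rfl
  have hd : d ∈ X.toFloerNovikovData.op.graded K (-k) := by
    refine Submodule.sub_mem _ ?_ (hh' _)
    rw [← hgr]
    exact X.toFloerNovikovData.op.gen_mem_graded p
  refine hp ((hpair c hc).symm.trans (hann d hd ?_ ?_))
  · refine (X.toFloerNovikovData.op.level_lt_iff _ _).mpr fun q hq => neg_lt_neg ?_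
    have hgen : X.gen K q ∈ X.graded K k := by
      have : X.gr q = k := neg_injective (hd q hq)
      exact this ▸ X.gen_mem_graded q
    rw [← X.pairing_gen_right d q, hpair _ hgen] at hq
    -- Neither q nor ∂hq exceeds the level 𝒜(q), so a nonzero coefficient at p forces α < 𝒜(p) ≤
    -- 𝒜(q).
    have hlev : X.gen K q - X.bd (h (X.gen K q)) ∈ X.filtLE K (X.action q) :=
      Submodule.sub_mem _ (X.level_gen_le q) (hle _ hgen _ (X.level_gen_le q))
    exact hpα.trans_le ((X.level_le_iff _ _).mp hlev p hq)
  · have hδ : X.delta d ∈ X.toFloerNovikovData.op.graded K (-k - 1) :=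
      X.op.bd_graded (-k) d hd
    refine X.toFloerNovikovData.op.graded_ext hδ (zero_mem _) fun q hq => ?_
    have hgen : X.gen K q ∈ X.graded K (k + 1) := by
      have h1 : -X.gr q = -k - 1 := hq
      have : X.gr q = k + 1 := by linarith
      exact this ▸ X.gen_mem_graded q
    have hbd : X.bd (X.gen K q) ∈ X.graded K k := by
      have := X.bd_graded (k + 1) _ hgen
      rwa [add_sub_cancel_right] at this
    -- The coefficient of δd at q is that of ∂q − ∂h∂q at p, which is zero.
    rw [← X.pairing_gen_right (X.delta d) q, X.pairing_delta, hpair _ hbd, hinv _ hgen, sub_self]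
    rfl

end FloerNovikovComplex

/-! ### Nondegeneracy on homology. -/

theorem mainTheorem1 {K Γ P S : Type*} [Field K] [CommGroup Γ]
    (X : FloerNovikovComplex K Γ P S)
    (hinj : Set.InjOn X.period {g | X.deg g = 0})
    (α : ℝ) (k : ℤ) :
    (X.homologyPairing α k).Nondegenerate := by
  -- Both halves are in contrapositive form: a class pairing to zero with every class is zero. The
  -- pairing of two classes unfolds to Δ of representatives, so `hb` and `ha` apply directly to
  -- chains.
  constructor
  · intro b hb
    obtain ⟨⟨d, hdk, hd0⟩, rfl⟩ := Submodule.mkQ_surjective _ b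
    obtain ⟨e, hek, heα, he⟩ := X.exists_delta_eq hinj α k (d := d.1) hdk fun c hc hbc =>
      hb (gradedClass (X.gradedGT α) (X.bdGT α) k ⟨X.projGT α c, ⟨c, hc, rfl⟩,
        (Submodule.Quotient.mk_eq_zero _).mpr hbc⟩)
    refine (Submodule.Quotient.mk_eq_zero _).mpr ?_
    exact ⟨⟨e, heα⟩, hek, Subtype.ext he⟩
  · intro a ha
    obtain ⟨⟨_, ⟨c, hc, rfl⟩, hc0⟩, rfl⟩ := Submodule.mkQ_surjective _ a
    obtain ⟨e, hek, he⟩ := X.exists_sub_bd_mem_filtLE hinj α k hc fun d hdk hdα hd =>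
      ha (gradedClass (X.op.gradedLT (-α)) (X.op.bdLT (-α)) (-k) ⟨⟨d, hdα⟩, hdk, Subtype.ext hd⟩)
    refine (Submodule.Quotient.mk_eq_zero _).mpr ?_
    exact ⟨X.projGT α e, ⟨e, hek, rfl⟩, ((Submodule.Quotient.eq _).mpr he).symm⟩
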